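/- **Theorem 3.1.** Let $N\ge 3$, $n\ge 2$, let $A$ be a positive definite real symmetric $N\times N$ matrix, and let $a_1,\dots,a_n\in\mathbb R^N$ be pairwise distinct. Let $\mu$ be the Gaussian probability measure $$d\mu(x)=C\,\exp\Big(-\tfrac12\sum_{i=1}^n\langle A(x-a_i),x-a_i\rangle\Big)\,dx,\qquad C=\Big(\int_{\mathbb R^N}e^{-\frac12\sum_{i=1}^n\langle A(x-a_i),x-a_i\rangle}\,dx\Big)^{-1},$$ and let $H^1_\mu$ be the set of all real functions $\varphi\in L^2(\mathbb R^N,\mu)$ whose distributional gradient $\nabla\varphi$ belongs to $L^2(\mathbb R^N,\mu)^N$. Put $r_0=\frac12\min_{i\ne j}|a_i-a_j|$ and $c_o=\left(\frac{N-2}{2}\right)^2$. (i) For every $k\in[0,\pi^2)$, every $c\in(0,c_o]$ and every $\varphi\in H^1_\mu$, the function $\sum_{i=1}^n\frac{\varphi^2}{|x-a_i|^2}$ is $\mu$-integrable and $$c\int_{\mathbb R^N}\sum_{i=1}^n\frac{\varphi^2}{|x-a_i|^2}\,d\mu\le\int_{\mathbb R^N}|\nabla\varphi|^2\,d\mu+\Big[\frac{k+(n+1)c}{r_0^2}+\frac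 n2\operatorname{Tr}A\Big]\int_{\mathbb R^N}\varphi^2\,d\mu .$$ (ii) The constant $c_o$ is optimal: for every $c>c_o$ and every $K\in\mathbb R$ there is $\varphi\in H^1_\mu$ with $$c\int_{\mathbb R^N}\sum_{i=1}^n\frac{\varphi^2}{|x-a_i|^2}\,d\mu>\int_{\mathbb R^N}|\nabla\varphi|^2\,d\mu+K\int_{\mathbb R^N}\varphi^2\,d\mu .$$ -/

import Mathlib

open MeasureTheory
open scoped ContDiff

/-- The weight `exp(-½ ∑ᵢ ⟨A (x - aᵢ), x - aᵢ⟩)` on `ℝ^N`, before normalization. -/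
noncomputable def gaussianWeight {N n : ℕ} (A : Matrix (Fin N) (Fin N) ℝ)
    (a : Fin n → EuclideanSpace ℝ (Fin N)) (x : EuclideanSpace ℝ (Fin N)) : ℝ :=
  Real.exp (-(1 / 2 : ℝ) * ∑ i, inner ℝ (Matrix.toEuclideanLin A (x - a i)) (x - a i))

/-- The normalization constant `C = (∫ exp(-½ ∑ᵢ ⟨A (x - aᵢ), x - aᵢ⟩) dx)⁻¹`. -/
noncomputable def gaussianConst {N n : ℕ} (A : Matrix (Fin N) (Fin N) ℝ)
    (a : Fin n → EuclideanSpace ℝ (Fin N)) : ℝ :=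
  (∫ x, gaussianWeight A a x)⁻¹

/-- The multipolar Gaussian measure `dμ = C exp(-½ ∑ᵢ ⟨A (x - aᵢ), x - aᵢ⟩) dx`. -/
noncomputable def gaussianMeasure {N n : ℕ} (A : Matrix (Fin N) (Fin N) ℝ)
    (a : Fin n → EuclideanSpace ℝ (Fin N)) : Measure (EuclideanSpace ℝ (Fin N)) :=
  volume.withDensity fun x => ENNReal.ofReal (gaussianConst A a * gaussianWeight A a x)

/-- `G` is the distributional gradient of `φ` on `ℝ^N` (with respect to Lebesgue measure, tested
against `C_c^∞` functions). -/
def HasWeakGradient {N : ℕ} (φ : EuclideanSpace ℝ (Fin N) → ℝ)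
    (G : EuclideanSpace ℝ (Fin N) → EuclideanSpace ℝ (Fin N)) : Prop :=
  LocallyIntegrable φ ∧ LocallyIntegrable G ∧
    ∀ ψ : EuclideanSpace ℝ (Fin N) → ℝ, ContDiff ℝ ∞ ψ → HasCompactSupport ψ →
      ∀ v : EuclideanSpace ℝ (Fin N),
        ∫ x, φ x * fderiv ℝ ψ x v = -∫ x, inner ℝ (G x) v * ψ x

/-- `φ` belongs to the weighted Sobolev space `H¹_μ`, and `G` is its distributional gradient:
`φ ∈ L²_μ`, `∇φ = G` in the sense of distributions and `G ∈ (L²_μ)^N`. -/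
structure MemH1 {N : ℕ} (μ : Measure (EuclideanSpace ℝ (Fin N)))
    (φ : EuclideanSpace ℝ (Fin N) → ℝ)
    (G : EuclideanSpace ℝ (Fin N) → EuclideanSpace ℝ (Fin N)) : Prop where
  memLp : MemLp φ 2 μ
  memLp_grad : MemLp G 2 μ
  hasWeakGradient : HasWeakGradient φ G

/-- The potential `V_n(x) = ∑ᵢ 1 / |x - aᵢ|²`. -/
noncomputable def multipolarPotential {N n : ℕ} (a : Fin n → EuclideanSpace ℝ (Fin N))
    (x : EuclideanSpace ℝ (Fin N)) : ℝ :=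
  ∑ i, 1 / ‖x - a i‖ ^ 2

/-- `r₀ = min_{i ≠ j} |aᵢ - aⱼ| / 2`: the infimum is over a finite set of pairs, which is non-empty
as soon as there are two poles. -/
noncomputable def poleRadius {N n : ℕ} (a : Fin n → EuclideanSpace ℝ (Fin N)) : ℝ :=
  (⨅ p : {p : Fin n × Fin n // p.1 ≠ p.2}, ‖a p.1.1 - a p.1.2‖) / 2

/-- The constant `c_o(N) = ((N - 2) / 2)²`. -/
noncomputable def hardyConst (N : ℕ) : ℝ := (((N : ℝ) - 2) / 2) ^ 2

/-! ### Mollification in `L²`. -/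

section Mollification

open scoped Convolution Topology
open Filter Metric ContinuousLinearMap

variable {E : Type*} [NormedAddCommGroup E] [InnerProductSpace ℝ E] [FiniteDimensional ℝ E]
  [MeasurableSpace E] [BorelSpace E]

/-! The upper bound is the vector field method. Write the Gaussian density as `ρ` with `∇ρ = -ρ b`,
where `b` is affine and `div b = n Tr A`. For a bounded `C¹` field `F`, put `W = F - b/2`, integrate
`φ² div(ρ W)` by parts and use `|∇φ + φ W|² ≥ 0`. The result is `∫ (div F - |F|²) φ² dμ ≤ ∫ |∇φ|² dμ
+ (n/2) Tr A ∫ φ² dμ`, after a nonnegative term `|b|²/4` is dropped (`integral_cutoff_mul_sq_le`,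
`MemH1.integral_mul_sq_le`). It remains to find `F` with `div F - |F|² ≥ c_o (V - (n+1)/r₀²)`, where
`V` is the regularized potential; the loss must be exactly this small.

After scaling to `r₀ = 1` and dividing out `α = (N-2)/2`, the field is a weighted sum of radial
fields `P(qᵢ)(x - bᵢ)`, with `qᵢ = |x - bᵢ|² + ε²`. Each has the optimal profile `1/q` at its pole
and tapers to `s/q` for `q ≥ 1`. Near one pole the fields of the others are damped by `χ = (1 -
(1-q)₊²)^α`; the exponent is chosen so that the gradient of `χ` cancels the singular part of the
cross terms in `|F|²`. What is left are scalar inequalities in `n`, `q` and `B = ∑ 1/qⱼ` over the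
far poles. They hold with `s = 3/4` for `n ≤ 9`. For `n ≥ 10` they hold with `s = 0`, where each
field lives in the unit ball of its pole. This is `multipolarField_estimate`; letting `ε → 0` with
Fatou's lemma gives both integrability and the inequality at `c = c_o` and `k = 0`
(`multipolar_hardy`). Smaller `c` and larger `k` follow by scaling.

For optimality one pole `p` suffices, since the others only enlarge the potential. The test function
is the critical power `|x - p|^(-α)`, cut off at scales `κ ≪ δ`. Its Hardy integral grows like `log
(δ/κ)`, the errors from the cutoffs stay bounded as `κ → 0`, and the `L²` term is small compared
with the Hardy integral when `δ` is small (`exists_sq_deriv_criticalProfile_le`, `exists_hardy_lt`).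
-/

theorem sq_convolution_normed_le (η : ContDiffBump (0 : E)) {f : E → ℝ} (hf : MemLp f 2) (x : E) :
    (η.normed volume ⋆[lsmul ℝ ℝ, volume] f) x ^ 2 ≤
      (η.normed volume ⋆[lsmul ℝ ℝ, volume] fun y => f y ^ 2) x := by
  have hη : HasCompactSupport (η.normed volume) := η.hasCompactSupport_normed
  have hηc : Continuous (η.normed volume) := η.continuous_normed
  have h1 : ConvolutionExistsAt (η.normed volume) f x (lsmul ℝ ℝ) volume :=
    hη.convolutionExists_left _ hηc (hf.locallyIntegrable one_le_two) x
  have h2 : ConvolutionExistsAt (η.normed volume) (fun y => f y ^ 2) x (lsmul ℝ ℝ) volume :=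
    hη.convolutionExists_left _ hηc hf.integrable_sq.locallyIntegrable x
  set m := (η.normed volume ⋆[lsmul ℝ ℝ, volume] f) x with hm
  have h1' : Integrable fun t => η.normed volume t * f (x - t) := h1
  have h2' : Integrable fun t => η.normed volume t * f (x - t) ^ 2 := h2
  have hm' : m = ∫ t, η.normed volume t * f (x - t) := hm
  -- Jensen for the square: `m` is the mean of `f (x - t)` under the probability density `η.normed`,
  -- and its variance is nonnegative.
  have h0 : 0 ≤ ∫ t, η.normed volume t * (f (x - t) - m) ^ 2 :=
    integral_nonneg fun t => mul_nonneg (η.nonneg_normed t) (sq_nonneg _)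
  have h3 : ∫ t, η.normed volume t * (f (x - t) - m) ^ 2 =
      (∫ t, η.normed volume t * f (x - t) ^ 2) - 2 * m * (∫ t, η.normed volume t * f (x - t)) +
        m ^ 2 * ∫ t, η.normed volume t := by
    have h4 : Integrable fun t => η.normed volume t * f (x - t) ^ 2 -
        2 * m * (η.normed volume t * f (x - t)) := h2'.sub (h1'.const_mul _)
    rw [← integral_const_mul, ← integral_const_mul, ← integral_sub h2' (h1'.const_mul _),
      ← integral_add h4 (η.integrable_normed.const_mul _)]
    exact integral_congr_ae (Eventually.of_forall fun t => by simp only; ring)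
  rw [h3, η.integral_normed, ← hm'] at h0
  change m ^ 2 ≤ ∫ t, η.normed volume t * f (x - t) ^ 2
  nlinarith

theorem integrable_sq_convolution_normed (η : ContDiffBump (0 : E)) {f : E → ℝ} (hf : MemLp f 2) :
    Integrable (fun x => (η.normed volume ⋆[lsmul ℝ ℝ, volume] f) x ^ 2) := by
  have hη : HasCompactSupport (η.normed volume) := η.hasCompactSupport_normed
  refine Integrable.mono' (η.integrable_normed.integrable_convolution (lsmul ℝ ℝ) hf.integrable_sq)
    ?_ (Eventually.of_forall fun x => ?_)
  · have hc : ContDiff ℝ (0 : ℕ∞) (η.normed volume ⋆[lsmul ℝ ℝ, volume] f) :=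
      hη.contDiff_convolution_left _ η.contDiff_normed (hf.locallyIntegrable one_le_two)
    exact (hc.continuous.pow 2).aestronglyMeasurable
  · rw [Real.norm_of_nonneg (sq_nonneg _)]
    exact sq_convolution_normed_le η hf x

theorem memLp_convolution_normed (η : ContDiffBump (0 : E)) {f : E → ℝ} (hf : MemLp f 2) :
    MemLp (η.normed volume ⋆[lsmul ℝ ℝ, volume] f) 2 := by
  have hη : HasCompactSupport (η.normed volume) := η.hasCompactSupport_normed
  have hc : ContDiff ℝ (0 : ℕ∞) (η.normed volume ⋆[lsmul ℝ ℝ, volume] f) :=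
    hη.contDiff_convolution_left _ η.contDiff_normed (hf.locallyIntegrable one_le_two)
  exact (memLp_two_iff_integrable_sq hc.continuous.aestronglyMeasurable).2
    (integrable_sq_convolution_normed η hf)

theorem integral_sq_convolution_normed_le (η : ContDiffBump (0 : E)) {f : E → ℝ}
    (hf : MemLp f 2) :
    ∫ x, (η.normed volume ⋆[lsmul ℝ ℝ, volume] f) x ^ 2 ≤ ∫ x, f x ^ 2 := by
  calc _ ≤ ∫ x, (η.normed volume ⋆[lsmul ℝ ℝ, volume] fun y => f y ^ 2) x :=
        integral_mono (integrable_sq_convolution_normed η hf)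
          (η.integrable_normed.integrable_convolution (lsmul ℝ ℝ) hf.integrable_sq)
          (sq_convolution_normed_le η hf)
    _ = _ := by
        rw [integral_convolution _ η.integrable_normed hf.integrable_sq, η.integral_normed]
        simp

/-- Uniform continuity makes the difference small everywhere, and once the kernel radius is below
`1` the difference vanishes outside a fixed ball of finite volume. -/
theorem tendsto_integral_sq_convolution_normed_sub_of_continuous {ι : Type*} {l : Filter ι}
    {η : ι → ContDiffBump (0 : E)} (hη : Tendsto (fun i => (η i).rOut) l (𝓝 0)) {g : E → ℝ}
    (hg : Continuous g) (hgc : HasCompactSupport g) :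
    Tendsto (fun i => ∫ x, (((η i).normed volume ⋆[lsmul ℝ ℝ, volume] g) x - g x) ^ 2) l
      (𝓝 0) := by
  obtain ⟨R, hR⟩ := hgc.isCompact.isBounded.subset_closedBall 0
  set V := volume.real (closedBall (0 : E) (R + 1)) with hV
  have hV0 : 0 ≤ V := measureReal_nonneg
  rw [Metric.tendsto_nhds]
  intro e he
  obtain ⟨d, hd, hdV⟩ : ∃ d : ℝ, 0 < d ∧ d ^ 2 * V < e := by
    refine ⟨√(e / (2 * (V + 1))), Real.sqrt_pos.2 (by positivity), ?_⟩
    rw [Real.sq_sqrt (by positivity), div_mul_eq_mul_div, div_lt_iff₀ (by positivity)]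
    nlinarith
  obtain ⟨δ, hδ, hδg⟩ := Metric.uniformContinuous_iff.1
    (hgc.uniformContinuous_of_continuous hg) d hd
  have hev : ∀ᶠ i in l, (η i).rOut < min δ 1 := hη.eventually_lt_const (by positivity)
  filter_upwards [hev] with i hi
  have hpt : ∀ x, ‖(((η i).normed volume ⋆[lsmul ℝ ℝ, volume] g) x - g x) ^ 2‖ ≤ d ^ 2 := by
    intro x
    have h := ContDiffBump.dist_normed_convolution_le (φ := η i) (x₀ := x) (ε := d)
      (μ := volume) hg.aestronglyMeasurable (fun y hy => (hδg ((mem_ball.1 hy).trans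
        (hi.trans_le (min_le_left _ _)))).le)
    rw [Real.dist_eq] at h
    rw [norm_pow, Real.norm_eq_abs]
    exact pow_le_pow_left₀ (abs_nonneg _) h 2
  have hsupp : ∀ x, x ∉ closedBall (0 : E) (R + 1) →
      (((η i).normed volume ⋆[lsmul ℝ ℝ, volume] g) x - g x) ^ 2 = 0 := by
    intro x hx
    have hz : ∀ y ∈ ball x (η i).rOut, g y = 0 := by
      intro y hy
      by_contra hne
      have hy' := hR (subset_tsupport g hne)
      rw [mem_closedBall] at hx hy'
      have := dist_triangle_left x 0 y
      have := mem_ball.1 hy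
      have := hi.trans_le (min_le_right _ _)
      linarith
    have h0 : g x = 0 := hz x (mem_ball_self (η i).rOut_pos)
    rw [ContDiffBump.normed_convolution_eq_right fun y hy => by rw [hz y hy, h0], h0]
    simp
  rw [← setIntegral_eq_integral_of_forall_compl_eq_zero hsupp, Real.dist_eq, sub_zero]
  refine lt_of_le_of_lt ?_ hdV
  exact norm_setIntegral_le_of_norm_le_const (measure_closedBall_lt_top) fun x _ => hpt x

theorem tendsto_integral_sq_convolution_normed_sub {ι : Type*} {l : Filter ι}
    {η : ι → ContDiffBump (0 : E)} (hη : Tendsto (fun i => (η i).rOut) l (𝓝 0)) {f : E → ℝ}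
    (hf : MemLp f 2) :
    Tendsto (fun i => ∫ x, (((η i).normed volume ⋆[lsmul ℝ ℝ, volume] f) x - f x) ^ 2) l
      (𝓝 0) := by
  rw [Metric.tendsto_nhds]
  intro e he
  -- The error splits as `η ⋆ (f - g) + (η ⋆ g - g) - (f - g)`. With `(a + b + c)² ≤ 3 (a² + b² +
  -- c²)` and `e / 12` for each square, the total is at most `3 e / 4 < e`.
  obtain ⟨g, hgc, hge, hg, hg2⟩ := MemLp.exists_hasCompactSupport_integral_rpow_sub_le
    (p := 2) (by norm_num) (f := f) (by simpa using hf) (ε := e / 12) (by positivity)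
  have hg2 : MemLp g 2 := by simpa using hg2
  have hge : ∫ x, (f x - g x) ^ 2 ≤ e / 12 := by
    refine le_trans (le_of_eq ?_) hge
    exact integral_congr_ae (Eventually.of_forall fun x => by simp)
  have hlim := tendsto_integral_sq_convolution_normed_sub_of_continuous hη hg hgc
  filter_upwards [hlim.eventually_lt_const (show (0 : ℝ) < e / 12 by positivity)] with i hi
  have hfg : MemLp (f - g) 2 := hf.sub hg2
  have hηs : HasCompactSupport ((η i).normed volume) := (η i).hasCompactSupport_normed
  have hηc : Continuous ((η i).normed volume) := (η i).continuous_normed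
  have hsub : ∀ x, ((η i).normed volume ⋆[lsmul ℝ ℝ, volume] (f - g)) x =
      ((η i).normed volume ⋆[lsmul ℝ ℝ, volume] f) x -
        ((η i).normed volume ⋆[lsmul ℝ ℝ, volume] g) x := by
    intro x
    have h1 : Integrable fun t => (η i).normed volume t * f (x - t) :=
      hηs.convolutionExists_left (lsmul ℝ ℝ) hηc (hf.locallyIntegrable one_le_two) x
    have h2 : Integrable fun t => (η i).normed volume t * g (x - t) :=
      hηs.convolutionExists_left (lsmul ℝ ℝ) hηc (hg2.locallyIntegrable one_le_two) x
    simp only [convolution_def, lsmul_apply, smul_eq_mul, Pi.sub_apply, mul_sub]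
    exact integral_sub h1 h2
  have hA := integrable_sq_convolution_normed (η i) hfg
  have hB := ((memLp_convolution_normed (η i) hg2).sub hg2).integrable_sq
  have hC := hfg.integrable_sq
  have hle : ∀ x, (((η i).normed volume ⋆[lsmul ℝ ℝ, volume] f) x - f x) ^ 2 ≤
      3 * (((η i).normed volume ⋆[lsmul ℝ ℝ, volume] (f - g)) x ^ 2 +
        ((((η i).normed volume ⋆[lsmul ℝ ℝ, volume] g) - g) x) ^ 2 + (f - g) x ^ 2) := by
    intro x
    rw [hsub]
    simp only [Pi.sub_apply]
    set p := ((η i).normed volume ⋆[lsmul ℝ ℝ, volume] f) x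
    set q := ((η i).normed volume ⋆[lsmul ℝ ℝ, volume] g) x
    nlinarith [sq_nonneg ((p - q) - (q - g x)), sq_nonneg ((p - q) + (f x - g x)),
      sq_nonneg ((q - g x) + (f x - g x))]
  have h1 := integral_sq_convolution_normed_le (η i) hfg
  have hi0 : 0 ≤ ∫ x, (((η i).normed volume ⋆[lsmul ℝ ℝ, volume] f) x - f x) ^ 2 :=
    integral_nonneg fun x => sq_nonneg _
  have hAB : Integrable fun x => ((η i).normed volume ⋆[lsmul ℝ ℝ, volume] (f - g)) x ^ 2 +
        ((((η i).normed volume ⋆[lsmul ℝ ℝ, volume] g) - g) x) ^ 2 := hA.add hB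
  have hABC : Integrable fun x => 3 * (((η i).normed volume ⋆[lsmul ℝ ℝ, volume] (f - g)) x ^ 2 +
        ((((η i).normed volume ⋆[lsmul ℝ ℝ, volume] g) - g) x) ^ 2 + (f - g) x ^ 2) :=
    (hAB.add hC).const_mul 3
  have h2 := integral_mono ((memLp_convolution_normed (η i) hf).sub hf).integrable_sq hABC hle
  rw [integral_const_mul, integral_add hAB hC, integral_add hA hB] at h2
  simp only [Pi.sub_apply] at h1 h2
  rw [Real.dist_eq, sub_zero, abs_of_nonneg hi0]
  linarith

end Mollification

/-! ### Products of `L²`-convergent families. -/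

section L2Limits

open Filter
open scoped Topology

theorem abs_integral_mul_le_sqrt {α : Type*} [MeasurableSpace α] {μ : Measure α} {f g : α → ℝ}
    (hf : MemLp f 2 μ) (hg : MemLp g 2 μ) :
    |∫ x, f x * g x ∂μ| ≤ √(∫ x, f x ^ 2 ∂μ) * √(∫ x, g x ^ 2 ∂μ) := by
  have h := integral_mul_norm_le_Lp_mul_Lq (μ := μ) (f := f) (g := g) (p := 2) (q := 2)
    Real.HolderConjugate.two_two (by simpa using hf) (by simpa using hg)
  rw [Real.sqrt_eq_rpow, Real.sqrt_eq_rpow]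
  refine (abs_integral_le_integral_abs).trans ?_
  simpa [abs_mul] using h

/-- Cauchy–Schwarz on each term of `u w - f g = (u - f)(w - g) + f (w - g) + (u - f) g`. -/
theorem tendsto_integral_mul_of_tendsto_integral_sq_sub {α ι : Type*} [MeasurableSpace α]
    {μ : Measure α} {l : Filter ι} {u w : ι → α → ℝ} {f g : α → ℝ}
    (hu : ∀ i, MemLp (u i) 2 μ) (hw : ∀ i, MemLp (w i) 2 μ) (hf : MemLp f 2 μ) (hg : MemLp g 2 μ)
    (huf : Tendsto (fun i => ∫ x, (u i x - f x) ^ 2 ∂μ) l (𝓝 0))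
    (hwg : Tendsto (fun i => ∫ x, (w i x - g x) ^ 2 ∂μ) l (𝓝 0)) :
    Tendsto (fun i => ∫ x, u i x * w i x ∂μ) l (𝓝 (∫ x, f x * g x ∂μ)) := by
  rw [tendsto_iff_dist_tendsto_zero]
  have hsu := (Real.continuous_sqrt.tendsto 0).comp huf
  have hsw := (Real.continuous_sqrt.tendsto 0).comp hwg
  rw [Real.sqrt_zero] at hsu hsw
  have hlim := ((hsu.mul hsw).add (hsw.const_mul √(∫ x, f x ^ 2 ∂μ))).add
    (hsu.mul_const √(∫ x, g x ^ 2 ∂μ))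
  simp only [mul_zero, zero_mul, add_zero] at hlim
  refine squeeze_zero (fun i => dist_nonneg) (fun i => ?_) hlim
  have e1 := abs_integral_mul_le_sqrt ((hu i).sub hf) ((hw i).sub hg)
  have e2 := abs_integral_mul_le_sqrt hf ((hw i).sub hg)
  have e3 := abs_integral_mul_le_sqrt ((hu i).sub hf) hg
  have i1 : Integrable (fun x => (u i x - f x) * (w i x - g x)) μ :=
    ((hu i).sub hf).integrable_mul ((hw i).sub hg)
  have i2 : Integrable (fun x => f x * (w i x - g x)) μ := hf.integrable_mul ((hw i).sub hg)
  have i3 : Integrable (fun x => (u i x - f x) * g x) μ := ((hu i).sub hf).integrable_mul hg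
  have i12 : Integrable (fun x => (u i x - f x) * (w i x - g x) + f x * (w i x - g x)) μ :=
    i1.add i2
  have key : ∫ x, u i x * w i x ∂μ - ∫ x, f x * g x ∂μ =
      (∫ x, (u i x - f x) * (w i x - g x) ∂μ + ∫ x, f x * (w i x - g x) ∂μ) +
        ∫ x, (u i x - f x) * g x ∂μ := by
    have i4 : Integrable (fun x => u i x * w i x) μ := (hu i).integrable_mul (hw i)
    have i5 : Integrable (fun x => f x * g x) μ := hf.integrable_mul hg
    rw [← integral_add i1 i2, ← integral_add i12 i3, ← integral_sub i4 i5]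
    exact integral_congr_ae (Eventually.of_forall fun x => by simp only; ring)
  rw [Real.dist_eq, key]
  simp only [Pi.sub_apply] at e1 e2 e3
  refine (abs_add_three _ _ _).trans ?_
  simp only [Function.comp_apply]
  linarith

end L2Limits

/-! ### Weak gradients and integration by parts for `φ²`. -/

section WeakGradient

open Filter Metric ContinuousLinearMap
open scoped Convolution Topology

/-- The divergence of a vector field on `ℝ^N`. -/
noncomputable def divergence {N : ℕ} (X : EuclideanSpace ℝ (Fin N) → EuclideanSpace ℝ (Fin N))
    (x : EuclideanSpace ℝ (Fin N)) : ℝ :=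
  ∑ k, (fderiv ℝ X x (EuclideanSpace.single k 1)) k

variable {N : ℕ} {φ : EuclideanSpace ℝ (Fin N) → ℝ}
  {G : EuclideanSpace ℝ (Fin N) → EuclideanSpace ℝ (Fin N)}

/-- The derivative falls on the kernel, and `t ↦ η (x - t)` is an admissible test function; the sign
from the reflection cancels the sign in the definition of the weak gradient. -/
theorem HasWeakGradient.fderiv_convolution_normed (h : HasWeakGradient φ G)
    (η : ContDiffBump (0 : EuclideanSpace ℝ (Fin N))) (x v : EuclideanSpace ℝ (Fin N)) :
    fderiv ℝ (η.normed volume ⋆[lsmul ℝ ℝ, volume] φ) x v =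
      (η.normed volume ⋆[lsmul ℝ ℝ, volume] fun y => inner ℝ (G y) v) x := by
  have hη : HasCompactSupport (η.normed volume) := η.hasCompactSupport_normed
  have hηs : ContDiff ℝ ∞ (η.normed volume) := η.contDiff_normed
  have hη1 : ContDiff ℝ 1 (η.normed volume) := η.contDiff_normed
  rw [(hη.hasFDerivAt_convolution_left (lsmul ℝ ℝ) hη1 h.1 x).fderiv]
  have hint : Integrable fun t => ((lsmul ℝ ℝ : ℝ →L[ℝ] ℝ →L[ℝ] ℝ).precompL
      (EuclideanSpace ℝ (Fin N))) (fderiv ℝ (η.normed volume) t) (φ (x - t)) :=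
    (hη.fderiv ℝ).convolutionExists_left _ (hη1.continuous_fderiv one_ne_zero) h.1 x
  rw [convolution_def, ContinuousLinearMap.integral_apply hint]
  simp only [precompL_apply, lsmul_apply, smul_eq_mul]
  rw [convolution_eq_swap]
  simp only [lsmul_apply, smul_eq_mul]
  have hψ : ContDiff ℝ ∞ fun t => η.normed volume (x - t) := hηs.comp (contDiff_const.sub contDiff_id)
  have hψc : HasCompactSupport fun t => η.normed volume (x - t) :=
    hη.comp_homeomorph (Homeomorph.subLeft x)
  have hfd : ∀ t, fderiv ℝ (fun t => η.normed volume (x - t)) t v =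
      -fderiv ℝ (η.normed volume) (x - t) v := by
    intro t
    have h1 : HasFDerivAt (η.normed volume) (fderiv ℝ (η.normed volume) (x - t)) (x - t) :=
      (hη1.differentiable one_ne_zero _).hasFDerivAt
    have h2 := h1.comp t ((hasFDerivAt_const x t).sub (hasFDerivAt_id t))
    have h3 := h2.fderiv
    simp only [Function.comp_def] at h3
    rw [h3]
    simp
  have hw := h.2.2 _ hψ hψc v
  simp only [hfd, mul_neg, integral_neg, neg_inj] at hw
  rw [← integral_sub_left_eq_self _ volume x]
  simp only [sub_sub_cancel]
  calc _ = ∫ t, φ t * fderiv ℝ (η.normed volume) (x - t) v :=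
        integral_congr_ae (Eventually.of_forall fun t => mul_comm _ _)
    _ = _ := hw.trans (integral_congr_ae (Eventually.of_forall fun t => mul_comm _ _))

/-- A kernel of radius at most `1` sees only the ball of radius `R + 1`. This lets functions that
are only locally `L²` be truncated, so that the global `L²` results apply. -/
theorem convolution_normed_indicator_eq {E : Type*} [NormedAddCommGroup E] [InnerProductSpace ℝ E]
    [FiniteDimensional ℝ E] [MeasurableSpace E] [BorelSpace E]
    (η : ContDiffBump (0 : E)) (hη : η.rOut ≤ 1) (f : E → ℝ) {R : ℝ} {x : E}
    (hx : x ∈ closedBall (0 : E) R) :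
    (η.normed volume ⋆[lsmul ℝ ℝ, volume] f) x =
      (η.normed volume ⋆[lsmul ℝ ℝ, volume] (closedBall (0 : E) (R + 1)).indicator f) x := by
  simp only [convolution_def]
  refine integral_congr_ae (Eventually.of_forall fun t => ?_)
  simp only [lsmul_apply, smul_eq_mul]
  by_cases ht : t ∈ ball (0 : E) η.rOut
  · rw [Set.indicator_of_mem]
    rw [mem_closedBall_zero_iff] at hx ⊢
    rw [mem_ball_zero_iff] at ht
    exact (norm_sub_le _ _).trans (by linarith)
  · rw [← η.support_normed_eq (μ := volume), Function.notMem_support] at ht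
    simp [ht]

/-- For the mollification `u` of `φ` this is classical integration by parts with `∂(u²) = 2 u ∂u`.
Both sides are integrals of products, so they pass to the `L²` limit. -/
theorem HasWeakGradient.integral_sq_mul_fderiv (h : HasWeakGradient φ G)
    (hφ : ∀ R, MemLp φ 2 (volume.restrict (closedBall 0 R)))
    (hG : ∀ R, MemLp G 2 (volume.restrict (closedBall 0 R)))
    {Y : EuclideanSpace ℝ (Fin N) → ℝ} (hY : ContDiff ℝ 1 Y) (hYc : HasCompactSupport Y)
    (v : EuclideanSpace ℝ (Fin N)) :
    ∫ x, φ x ^ 2 * fderiv ℝ Y x v = -2 * ∫ x, φ x * (inner ℝ (G x) v * Y x) := by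
  obtain ⟨R, hR⟩ := hYc.isCompact.isBounded.subset_closedBall 0
  set S := closedBall (0 : EuclideanSpace ℝ (Fin N)) (R + 1) with hS
  have hSm : MeasurableSet S := measurableSet_closedBall
  have hRS : closedBall (0 : EuclideanSpace ℝ (Fin N)) R ⊆ S := closedBall_subset_closedBall (by simp)
  set f := S.indicator φ with hf
  set g := S.indicator (fun y => inner ℝ (G y) v) with hg
  have hf2 : MemLp f 2 := (memLp_indicator_iff_restrict hSm).2 (hφ _)
  have hg2 : MemLp g 2 := (memLp_indicator_iff_restrict hSm).2 ((hG _).inner_const v)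
  let η : ℕ → ContDiffBump (0 : EuclideanSpace ℝ (Fin N)) := fun i =>
    ⟨1 / ((i : ℝ) + 1) / 2, 1 / ((i : ℝ) + 1), by positivity, by
      have : 0 < 1 / ((i : ℝ) + 1) := by positivity
      linarith⟩
  have hη : Tendsto (fun i => (η i).rOut) atTop (𝓝 0) := tendsto_one_div_add_atTop_nhds_zero_nat
  have hη1 : ∀ i, (η i).rOut ≤ 1 := fun i => by
    change 1 / ((i : ℝ) + 1) ≤ 1
    rw [div_le_one (by positivity)]
    have : (0 : ℝ) ≤ i := Nat.cast_nonneg i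
    linarith
  have hYR : ∀ x ∉ closedBall (0 : EuclideanSpace ℝ (Fin N)) R, Y x = 0 := fun x hx => by
    by_contra hne
    exact hx (hR (subset_tsupport _ hne))
  have hdYR : ∀ x ∉ closedBall (0 : EuclideanSpace ℝ (Fin N)) R, fderiv ℝ Y x v = 0 :=
    fun x hx => by
      by_contra hne
      have : fderiv ℝ Y x ≠ 0 := fun h0 => hne (by simp [h0])
      exact hx (hR (support_fderiv_subset ℝ this))
  have hdYc : Continuous fun x => fderiv ℝ Y x v :=
    (hY.continuous_fderiv one_ne_zero).clm_apply continuous_const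
  have hdYcs : HasCompactSupport fun x => fderiv ℝ Y x v := hYc.fderiv_apply ℝ v
  have hmul : ∀ {u Z : EuclideanSpace ℝ (Fin N) → ℝ}, MemLp u 2 → Continuous Z →
      HasCompactSupport Z → MemLp (fun x => u x * Z x) 2 := by
    intro u Z hu hZ hZc
    obtain ⟨C, hC⟩ := hZc.exists_bound_of_continuous hZ
    exact MemLp.of_le_mul (c := C) hu (hu.1.mul hZ.aestronglyMeasurable)
      (Eventually.of_forall fun x => by
        rw [norm_mul, mul_comm]
        exact mul_le_mul_of_nonneg_right (hC x) (norm_nonneg _))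
  have hlim : ∀ {F : EuclideanSpace ℝ (Fin N) → ℝ}, MemLp F 2 →
      ∀ {Z : EuclideanSpace ℝ (Fin N) → ℝ}, Continuous Z → HasCompactSupport Z →
      Tendsto (fun i => ∫ x, (((η i).normed volume ⋆[lsmul ℝ ℝ, volume] F) x * Z x -
        F x * Z x) ^ 2) atTop (𝓝 0) := by
    intro F hF Z hZ hZc
    obtain ⟨C, hC⟩ := hZc.exists_bound_of_continuous hZ
    have h0 := (tendsto_integral_sq_convolution_normed_sub hη hF).const_mul (C ^ 2)
    rw [mul_zero] at h0
    refine squeeze_zero (fun i => integral_nonneg fun x => sq_nonneg _) (fun i => ?_) h0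
    rw [← integral_const_mul]
    refine integral_mono (((hmul (memLp_convolution_normed (η i) hF) hZ hZc).sub
      (hmul hF hZ hZc)).integrable_sq)
      (((memLp_convolution_normed (η i) hF).sub hF).integrable_sq.const_mul _) fun x => ?_
    rw [← sub_mul, mul_pow, mul_comm]
    refine mul_le_mul_of_nonneg_right ?_ (sq_nonneg _)
    rw [← sq_abs]
    exact pow_le_pow_left₀ (abs_nonneg _) (hC x) 2
  have hL := tendsto_integral_mul_of_tendsto_integral_sq_sub
    (fun i => memLp_convolution_normed (η i) hf2)
    (fun i => hmul (memLp_convolution_normed (η i) hf2) hdYc hdYcs) hf2 (hmul hf2 hdYc hdYcs)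
    (tendsto_integral_sq_convolution_normed_sub hη hf2) (hlim hf2 hdYc hdYcs)
  have hRt := tendsto_integral_mul_of_tendsto_integral_sq_sub
    (fun i => memLp_convolution_normed (η i) hf2)
    (fun i => hmul (memLp_convolution_normed (η i) hg2) hY.continuous hYc) hf2
    (hmul hg2 hY.continuous hYc)
    (tendsto_integral_sq_convolution_normed_sub hη hf2) (hlim hg2 hY.continuous hYc)
  have hcl : ∀ i, ∫ x, ((η i).normed volume ⋆[lsmul ℝ ℝ, volume] f) x *
      (((η i).normed volume ⋆[lsmul ℝ ℝ, volume] f) x * fderiv ℝ Y x v) =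
      -2 * ∫ x, ((η i).normed volume ⋆[lsmul ℝ ℝ, volume] f) x *
      (((η i).normed volume ⋆[lsmul ℝ ℝ, volume] g) x * Y x) := by
    -- The truncations `f` and `g` serve only the `L²` limits. The calculus is done on the
    -- mollification of the untruncated `φ`, which agrees with that of `f` on the ball carrying `Y`.
    intro i
    set u := (η i).normed volume ⋆[lsmul ℝ ℝ, volume] φ with hu
    have hηs : HasCompactSupport ((η i).normed volume) := (η i).hasCompactSupport_normed
    have hu1 : ContDiff ℝ (1 : ℕ∞) u :=
      hηs.contDiff_convolution_left _ (η i).contDiff_normed h.1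
    have hu1 : ContDiff ℝ 1 u := hu1
    have hdu : ∀ x, fderiv ℝ u x v =
        ((η i).normed volume ⋆[lsmul ℝ ℝ, volume] fun y => inner ℝ (G y) v) x :=
      fun x => h.fderiv_convolution_normed (η i) x v
    have hu2 : ContDiff ℝ 1 fun x => u x ^ 2 := hu1.pow 2
    have hdu2 : ∀ x, fderiv ℝ (fun x => u x ^ 2) x v = 2 * u x * fderiv ℝ u x v := by
      intro x
      have := ((hu1.differentiable one_ne_zero x).hasFDerivAt.pow 2).fderiv
      rw [this]
      simp
    have hduc : Continuous fun x => fderiv ℝ (fun x => u x ^ 2) x v :=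
      (hu2.continuous_fderiv one_ne_zero).clm_apply continuous_const
    have hibp := integral_mul_fderiv_eq_neg_fderiv_mul_of_integrable (μ := volume)
      (f := fun x => u x ^ 2) (g := Y) (v := v)
      ((hduc.mul hY.continuous).integrable_of_hasCompactSupport hYc.mul_left)
      ((hu2.continuous.mul hdYc).integrable_of_hasCompactSupport hdYcs.mul_left)
      ((hu2.continuous.mul hY.continuous).integrable_of_hasCompactSupport hYc.mul_left)
      (fun x _ => hu2.differentiable one_ne_zero x) (fun x _ => hY.differentiable one_ne_zero x)
    have e1 : ∫ x, ((η i).normed volume ⋆[lsmul ℝ ℝ, volume] f) x *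
        (((η i).normed volume ⋆[lsmul ℝ ℝ, volume] f) x * fderiv ℝ Y x v) =
        ∫ x, u x ^ 2 * fderiv ℝ Y x v := by
      refine integral_congr_ae (Eventually.of_forall fun x => ?_)
      by_cases hx : x ∈ closedBall (0 : EuclideanSpace ℝ (Fin N)) R
      · simp only [hu, hf, convolution_normed_indicator_eq (η i) (hη1 i) φ hx]
        ring
      · simp [hdYR x hx]
    rw [e1, hibp, ← integral_const_mul, ← integral_neg]
    refine integral_congr_ae (Eventually.of_forall fun x => ?_)
    by_cases hx : x ∈ closedBall (0 : EuclideanSpace ℝ (Fin N)) R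
    · simp only [hdu2, hdu]
      simp only [hu, hf, hg, convolution_normed_indicator_eq (η i) (hη1 i) φ hx,
        convolution_normed_indicator_eq (η i) (hη1 i) (fun y => inner ℝ (G y) v) hx]
      ring
    · simp [hYR x hx]
  have hfin := tendsto_nhds_unique (hL.congr hcl) (hRt.const_mul (-2))
  have e1 : ∫ x, φ x ^ 2 * fderiv ℝ Y x v = ∫ x, f x * (f x * fderiv ℝ Y x v) := by
    refine integral_congr_ae (Eventually.of_forall fun x => ?_)
    by_cases hx : x ∈ closedBall (0 : EuclideanSpace ℝ (Fin N)) R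
    · simp only [hf, Set.indicator_of_mem (hRS hx)]
      ring
    · simp [hdYR x hx]
  have e2 : ∫ x, φ x * (inner ℝ (G x) v * Y x) = ∫ x, f x * (g x * Y x) := by
    refine integral_congr_ae (Eventually.of_forall fun x => ?_)
    by_cases hx : x ∈ closedBall (0 : EuclideanSpace ℝ (Fin N)) R
    · simp only [hf, hg, Set.indicator_of_mem (hRS hx)]
    · simp [hYR x hx]
  rw [e1, e2, hfin]

theorem locallyIntegrable_of_integrable_restrict_closedBall {F : Type*} [NormedAddCommGroup F]
    {f : EuclideanSpace ℝ (Fin N) → F}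
    (hf : ∀ R, Integrable f (volume.restrict (closedBall 0 R))) : LocallyIntegrable f := by
  rw [locallyIntegrable_iff]
  intro K hK
  obtain ⟨R, hR⟩ := hK.isBounded.subset_closedBall 0
  exact IntegrableOn.mono_set (hf R) hR

theorem divergence_smul {m : EuclideanSpace ℝ (Fin N) → ℝ}
    {X : EuclideanSpace ℝ (Fin N) → EuclideanSpace ℝ (Fin N)} {x : EuclideanSpace ℝ (Fin N)}
    (hm : DifferentiableAt ℝ m x) (hX : DifferentiableAt ℝ X x) :
    divergence (fun y => m y • X y) x = m x * divergence X x + fderiv ℝ m x (X x) := by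
  have hsum : X x = ∑ k, (X x) k • EuclideanSpace.single k (1 : ℝ) := by
    ext j
    simp [Pi.single_apply]
  have h : fderiv ℝ m x (X x) = ∑ k, (X x) k * fderiv ℝ m x (EuclideanSpace.single k 1) := by
    conv_lhs => rw [hsum]
    simp [map_sum]
  rw [h, divergence, divergence, Finset.mul_sum, ← Finset.sum_add_distrib]
  refine Finset.sum_congr rfl fun k _ => ?_
  rw [fderiv_fun_smul hm hX]
  simp
  ring

theorem divergence_sub {X Y : EuclideanSpace ℝ (Fin N) → EuclideanSpace ℝ (Fin N)}
    {x : EuclideanSpace ℝ (Fin N)} (hX : DifferentiableAt ℝ X x) (hY : DifferentiableAt ℝ Y x) :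
    divergence (fun y => X y - Y y) x = divergence X x - divergence Y x := by
  simp [divergence, fderiv_fun_sub hX hY]

theorem divergence_const_smul {X : EuclideanSpace ℝ (Fin N) → EuclideanSpace ℝ (Fin N)}
    {x : EuclideanSpace ℝ (Fin N)} (c : ℝ) (hX : DifferentiableAt ℝ X x) :
    divergence (fun y => c • X y) x = c * divergence X x := by
  simp [divergence, fderiv_fun_const_smul hX, Finset.mul_sum]

theorem divergence_sum {ι : Type*} (s : Finset ι)
    {X : ι → EuclideanSpace ℝ (Fin N) → EuclideanSpace ℝ (Fin N)}
    {x : EuclideanSpace ℝ (Fin N)} (hX : ∀ i ∈ s, DifferentiableAt ℝ (X i) x) :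
    divergence (fun y => ∑ i ∈ s, X i y) x = ∑ i ∈ s, divergence (X i) x := by
  simp only [divergence, fderiv_fun_sum hX]
  rw [Finset.sum_comm]
  simp

theorem divergence_id_sub (a x : EuclideanSpace ℝ (Fin N)) :
    divergence (fun y => y - a) x = N := by
  simp [divergence, fderiv_sub_const]

theorem divergence_comp_smul {X : EuclideanSpace ℝ (Fin N) → EuclideanSpace ℝ (Fin N)}
    (c : ℝ) (x : EuclideanSpace ℝ (Fin N)) (hX : DifferentiableAt ℝ X (c • x)) :
    divergence (fun y => X (c • y)) x = c * divergence X (c • x) := by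
  have h : HasFDerivAt (fun y => X (c • y))
      ((fderiv ℝ X (c • x)).comp (c • ContinuousLinearMap.id ℝ _)) x :=
    hX.hasFDerivAt.comp x ((hasFDerivAt_id x).const_smul c)
  simp [divergence, h.fderiv, Finset.mul_sum]

theorem continuous_divergence {X : EuclideanSpace ℝ (Fin N) → EuclideanSpace ℝ (Fin N)}
    (hX : ContDiff ℝ 1 X) : Continuous (divergence X) := by
  refine continuous_finsetSum _ fun k _ => ?_
  have := (hX.continuous_fderiv one_ne_zero).clm_apply
    (continuous_const (y := EuclideanSpace.single k (1 : ℝ)))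
  fun_prop

theorem hasCompactSupport_divergence
    {X : EuclideanSpace ℝ (Fin N) → EuclideanSpace ℝ (Fin N)} (hX : HasCompactSupport X) :
    HasCompactSupport (divergence X) := by
  refine (hX.fderiv ℝ).mono fun x hx => ?_
  contrapose! hx
  simp only [Function.notMem_support] at hx ⊢
  simp [divergence, hx]

theorem integrable_sq_mul_of_hasCompactSupport
    (hφ : ∀ R, MemLp φ 2 (volume.restrict (closedBall 0 R)))
    {Z : EuclideanSpace ℝ (Fin N) → ℝ} (hZ : Continuous Z) (hZc : HasCompactSupport Z) :
    Integrable fun x => φ x ^ 2 * Z x :=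
  (locallyIntegrable_of_integrable_restrict_closedBall
    fun R => (hφ R).integrable_sq).integrable_smul_right_of_hasCompactSupport hZ hZc

theorem integrable_mul_inner_of_hasCompactSupport
    (hφ : ∀ R, MemLp φ 2 (volume.restrict (closedBall 0 R)))
    (hG : ∀ R, MemLp G 2 (volume.restrict (closedBall 0 R)))
    {X : EuclideanSpace ℝ (Fin N) → EuclideanSpace ℝ (Fin N)} (hX : Continuous X)
    (hXc : HasCompactSupport X) :
    Integrable fun x => φ x * inner ℝ (G x) (X x) := by
  have hGk : ∀ k R, MemLp (fun x => G x k) 2 (volume.restrict (closedBall 0 R)) := by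
    intro k R
    have := (hG R).inner_const (𝕜 := ℝ) (EuclideanSpace.single k (1 : ℝ))
    simpa only [EuclideanSpace.inner_single_right, one_mul, conj_trivial] using this
  have hloc : ∀ k, LocallyIntegrable fun x => φ x * G x k := fun k =>
    locallyIntegrable_of_integrable_restrict_closedBall fun R => (hφ R).integrable_mul (hGk k R)
  have h : ∀ k, Integrable fun x => (φ x * G x k) * X x k := fun k =>
    (hloc k).integrable_smul_right_of_hasCompactSupport
      (by fun_prop) (hXc.comp_left (g := fun z : EuclideanSpace ℝ (Fin N) => z k) rfl)
  refine (integrable_finsetSum Finset.univ fun k _ => h k).congr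
    (Eventually.of_forall fun x => ?_)
  simp only [PiLp.inner_apply, Finset.mul_sum]
  refine Finset.sum_congr rfl fun k _ => ?_
  simp
  ring

theorem HasWeakGradient.integral_sq_mul_divergence (h : HasWeakGradient φ G)
    (hφ : ∀ R, MemLp φ 2 (volume.restrict (closedBall 0 R)))
    (hG : ∀ R, MemLp G 2 (volume.restrict (closedBall 0 R)))
    {X : EuclideanSpace ℝ (Fin N) → EuclideanSpace ℝ (Fin N)} (hX : ContDiff ℝ 1 X)
    (hXc : HasCompactSupport X) :
    ∫ x, φ x ^ 2 * divergence X x = -2 * ∫ x, φ x * inner ℝ (G x) (X x) := by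
  have hYk : ∀ k, ContDiff ℝ 1 fun x => X x k := fun k => contDiff_euclidean.1 hX k
  have hYc : ∀ k, HasCompactSupport fun x => X x k := fun k =>
    hXc.comp_left (g := fun z : EuclideanSpace ℝ (Fin N) => z k) rfl
  have hfd : ∀ k x v, fderiv ℝ (fun x => X x k) x v = (fderiv ℝ X x v) k := by
    intro k x v
    have h1 := ((EuclideanSpace.proj k : EuclideanSpace ℝ (Fin N) →L[ℝ] ℝ).hasFDerivAt
      (x := X x)).comp x (hX.differentiable one_ne_zero x).hasFDerivAt
    exact congrArg (fun L => L v) h1.fderiv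
  have hi1 : ∀ k, Integrable fun x => φ x ^ 2 *
      fderiv ℝ (fun x => X x k) x (EuclideanSpace.single k 1) := fun k =>
    integrable_sq_mul_of_hasCompactSupport hφ
      (((hYk k).continuous_fderiv one_ne_zero).clm_apply continuous_const)
      ((hYc k).fderiv_apply ℝ _)
  have hi2 : ∀ k, Integrable fun x => φ x *
      (inner ℝ (G x) (EuclideanSpace.single k (1 : ℝ)) * X x k) := fun k => by
    have := integrable_mul_inner_of_hasCompactSupport hφ hG
      (X := fun x => X x k • EuclideanSpace.single k (1 : ℝ))
      ((hYk k).continuous.smul continuous_const) (hYc k).smul_right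
    simpa [inner_smul_right, mul_comm] using this
  calc _ = ∫ x, ∑ k, φ x ^ 2 * fderiv ℝ (fun x => X x k) x (EuclideanSpace.single k 1) := by
        simp only [hfd, divergence, Finset.mul_sum]
    _ = ∑ k, -2 * ∫ x, φ x * (inner ℝ (G x) (EuclideanSpace.single k (1 : ℝ)) * X x k) := by
        rw [integral_finsetSum _ fun k _ => hi1 k]
        exact Finset.sum_congr rfl fun k _ => h.integral_sq_mul_fderiv hφ hG (hYk k) (hYc k) _
    _ = _ := by
        rw [← Finset.mul_sum, ← integral_finsetSum _ fun k _ => hi2 k]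
        congr 1
        refine integral_congr_ae (Eventually.of_forall fun x => ?_)
        simp only [PiLp.inner_apply, Finset.mul_sum]
        refine Finset.sum_congr rfl fun k _ => ?_
        simp [mul_comm]

end WeakGradient

/-! ### From a vector field to a weighted Hardy inequality. -/

section WeightedHardy

open Filter Metric
open scoped Topology

variable {N : ℕ} {φ : EuclideanSpace ℝ (Fin N) → ℝ}
  {G : EuclideanSpace ℝ (Fin N) → EuclideanSpace ℝ (Fin N)} {ρ : EuclideanSpace ℝ (Fin N) → ℝ}

theorem integral_withDensity_ofReal {α : Type*} [MeasurableSpace α] {μ : Measure α} {ρ : α → ℝ}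
    (hρ : Measurable ρ) (hρ0 : ∀ x, 0 ≤ ρ x) (f : α → ℝ) :
    ∫ x, f x ∂(μ.withDensity fun x => ENNReal.ofReal (ρ x)) = ∫ x, ρ x * f x ∂μ := by
  rw [integral_withDensity_eq_integral_toReal_smul hρ.ennreal_ofReal
    (Eventually.of_forall fun x => ENNReal.ofReal_lt_top)]
  simp [ENNReal.toReal_ofReal, hρ0]

theorem integrable_withDensity_ofReal_iff {α : Type*} [MeasurableSpace α] {μ : Measure α}
    {ρ : α → ℝ} (hρ : Measurable ρ) (hρ0 : ∀ x, 0 ≤ ρ x) {f : α → ℝ} :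
    Integrable f (μ.withDensity fun x => ENNReal.ofReal (ρ x)) ↔
      Integrable (fun x => ρ x * f x) μ := by
  rw [integrable_withDensity_iff_integrable_smul' hρ.ennreal_ofReal
    (Eventually.of_forall fun x => ENNReal.ofReal_lt_top)]
  simp [ENNReal.toReal_ofReal, hρ0]

/-- A continuous positive density is bounded below on compact sets. -/
theorem memLp_restrict_closedBall_of_memLp_withDensity {F : Type*} [NormedAddCommGroup F]
    (hρ : Continuous ρ) (hρ0 : ∀ x, 0 < ρ x) {f : EuclideanSpace ℝ (Fin N) → F}
    (hfm : AEStronglyMeasurable f)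
    (hf : MemLp f 2 (volume.withDensity fun x => ENNReal.ofReal (ρ x))) (R : ℝ) :
    MemLp f 2 (volume.restrict (closedBall 0 R)) := by
  have hi := (memLp_two_iff_integrable_sq_norm hf.1).1 hf
  rw [integrable_withDensity_ofReal_iff hρ.measurable fun x => (hρ0 x).le] at hi
  rw [memLp_two_iff_integrable_sq_norm hfm.restrict]
  have hinv : Continuous fun x => (ρ x)⁻¹ := hρ.inv₀ fun x => (hρ0 x).ne'
  obtain ⟨C, hC⟩ := (isCompact_closedBall (0 : EuclideanSpace ℝ (Fin N)) R).exists_bound_of_continuousOn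
    hinv.continuousOn
  refine Integrable.mono' (hi.restrict.const_mul C) (hfm.restrict.norm.pow 2) ?_
  filter_upwards [ae_restrict_mem measurableSet_closedBall] with x hx
  have h1 := hC x hx
  rw [Real.norm_of_nonneg (inv_nonneg.2 (hρ0 x).le)] at h1
  rw [Real.norm_of_nonneg (sq_nonneg _), ← mul_assoc]
  refine le_mul_of_one_le_left (sq_nonneg _) ?_
  calc (1 : ℝ) = (ρ x)⁻¹ * ρ x := (inv_mul_cancel₀ (hρ0 x).ne').symm
    _ ≤ C * ρ x := mul_le_mul_of_nonneg_right h1 (hρ0 x).le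

variable {b F : EuclideanSpace ℝ (Fin N) → EuclideanSpace ℝ (Fin N)} {τ M : ℝ}
  {Z : EuclideanSpace ℝ (Fin N) → ℝ}

/-- Test the integration by parts with `ρ η² W`, where `W = F - b/2`, and complete the square `|G +
φ W|² ≥ 0`. Since `div W - ⟨b, W⟩ - |W|² = div F - |F|² - τ/2 + |b|²/4`, the mixed terms `⟨F, b⟩`
cancel and a spare `|b|²/4` appears. -/
theorem integral_cutoff_mul_sq_le (hρ : ContDiff ℝ 1 ρ) (hρ0 : ∀ x, 0 < ρ x)
    (hb : ContDiff ℝ 1 b) (hρb : ∀ x v, fderiv ℝ ρ x v = -(ρ x * inner ℝ (b x) v))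
    (hτ : ∀ x, divergence b x = τ) (hτ0 : 0 ≤ τ)
    (hφ : MemH1 (volume.withDensity fun x => ENNReal.ofReal (ρ x)) φ G)
    (hF : ContDiff ℝ 1 F) (hFM : ∀ x, ‖F x‖ ≤ M) (hZ : Continuous Z)
    (hFZ : ∀ x, Z x ≤ divergence F x - ‖F x‖ ^ 2)
    {η : EuclideanSpace ℝ (Fin N) → ℝ} (hη : ContDiff ℝ 1 η) (hηc : HasCompactSupport η)
    (hη0 : ∀ x, 0 ≤ η x) (hη1 : ∀ x, η x ≤ 1) {D : ℝ} (hD : ∀ x, ‖fderiv ℝ η x‖ ≤ D) :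
    ∫ x, ρ x * (η x ^ 2 * (Z x * φ x ^ 2)) ≤
      (∫ x, ρ x * ‖G x‖ ^ 2) + (τ / 2 + (D ^ 2 + 2 * D * M)) * ∫ x, ρ x * φ x ^ 2 := by
  have hφl := memLp_restrict_closedBall_of_memLp_withDensity hρ.continuous hρ0
    hφ.hasWeakGradient.1.aestronglyMeasurable hφ.memLp
  have hGl := memLp_restrict_closedBall_of_memLp_withDensity hρ.continuous hρ0
    hφ.hasWeakGradient.2.1.aestronglyMeasurable hφ.memLp_grad
  have iφ : Integrable fun x => ρ x * φ x ^ 2 :=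
    (integrable_withDensity_ofReal_iff hρ.continuous.measurable fun x => (hρ0 x).le).1
      hφ.memLp.integrable_sq
  have iG : Integrable fun x => ρ x * ‖G x‖ ^ 2 :=
    (integrable_withDensity_ofReal_iff hρ.continuous.measurable fun x => (hρ0 x).le).1
      ((memLp_two_iff_integrable_sq_norm hφ.memLp_grad.1).1 hφ.memLp_grad)
  set W : EuclideanSpace ℝ (Fin N) → EuclideanSpace ℝ (Fin N) := fun x => F x - (1 / 2 : ℝ) • b x
    with hW
  have hWc : ContDiff ℝ 1 W := hF.sub (hb.const_smul _)
  set m : EuclideanSpace ℝ (Fin N) → ℝ := fun x => ρ x * η x ^ 2 with hm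
  have hmc : ContDiff ℝ 1 m := hρ.mul (hη.pow 2)
  have hms : HasCompactSupport m := by
    have : m = fun x => (ρ x * η x) * η x := by ext x; simp [hm]; ring
    rw [this]
    exact hηc.mul_left
  have hX : ContDiff ℝ 1 fun x => m x • W x := hmc.smul hWc
  have hXs : HasCompactSupport fun x => m x • W x := hms.smul_right
  have hibp := hφ.hasWeakGradient.integral_sq_mul_divergence hφl hGl hX hXs
  have i1 : Integrable fun x => φ x ^ 2 * divergence (fun x => m x • W x) x :=
    integrable_sq_mul_of_hasCompactSupport hφl (continuous_divergence hX)
      (hasCompactSupport_divergence hXs)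
  have i2 : Integrable fun x => φ x * inner ℝ (G x) (m x • W x) :=
    integrable_mul_inner_of_hasCompactSupport hφl hGl hX.continuous hXs
  have i3 : Integrable fun x => ρ x * (η x ^ 2 * (Z x * φ x ^ 2)) := by
    refine (integrable_sq_mul_of_hasCompactSupport hφl
      (hmc.continuous.mul hZ) hms.mul_right).congr (Eventually.of_forall fun x => ?_)
    simp only [hm, Pi.mul_apply]
    ring
  have hM0 : 0 ≤ M := (norm_nonneg _).trans (hFM 0)
  have hD0 : 0 ≤ D := (norm_nonneg _).trans (hD 0)
  have hpt : ∀ x, ρ x * (η x ^ 2 * (Z x * φ x ^ 2)) ≤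
      ρ x * ‖G x‖ ^ 2 + (τ / 2 + (D ^ 2 + 2 * D * M)) * (ρ x * φ x ^ 2) +
        (φ x ^ 2 * divergence (fun x => m x • W x) x + 2 * (φ x * inner ℝ (G x) (m x • W x))) := by
    intro x
    have hdF : DifferentiableAt ℝ F x := hF.differentiable one_ne_zero x
    have hdb : DifferentiableAt ℝ b x := hb.differentiable one_ne_zero x
    have hdη : DifferentiableAt ℝ η x := hη.differentiable one_ne_zero x
    have hdρ : DifferentiableAt ℝ ρ x := hρ.differentiable one_ne_zero x
    have hdm : fderiv ℝ m x (W x) = -(ρ x * η x ^ 2 * inner ℝ (b x) (W x)) +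
        2 * ρ x * η x * fderiv ℝ η x (W x) := by
      have h1 : HasFDerivAt m (ρ x • (((2 : ℕ) • η x ^ (2 - 1)) • fderiv ℝ η x) +
          η x ^ 2 • fderiv ℝ ρ x) x := hdρ.hasFDerivAt.mul (hdη.hasFDerivAt.pow 2)
      rw [h1.fderiv]
      simp [hρb]
      ring
    have hdW : divergence W x = divergence F x - τ / 2 := by
      have hdb' : DifferentiableAt ℝ (fun y => (1 / 2 : ℝ) • b y) x := by fun_prop
      rw [hW, divergence_sub hdF hdb', divergence_const_smul _ hdb, hτ]
      ring
    rw [divergence_smul (hmc.differentiable one_ne_zero x) (hWc.differentiable one_ne_zero x),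
      hdm, hdW]
    have hDW : fderiv ℝ η x (W x) = fderiv ℝ η x (F x) - 1 / 2 * fderiv ℝ η x (b x) := by
      simp [hW]
    have hdF1 : |fderiv ℝ η x (F x)| ≤ D * M :=
      ((fderiv ℝ η x).le_opNorm _).trans (mul_le_mul (hD x) (hFM x) (norm_nonneg _) hD0)
    have hdb1 : |fderiv ℝ η x (b x)| ≤ D * ‖b x‖ :=
      ((fderiv ℝ η x).le_opNorm _).trans (mul_le_mul_of_nonneg_right (hD x) (norm_nonneg _))
    have hbW : inner ℝ (b x) (W x) = inner ℝ (F x) (b x) - 1 / 2 * ‖b x‖ ^ 2 := by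
      simp only [hW, inner_sub_right, inner_smul_right, real_inner_self_eq_norm_sq]
      rw [real_inner_comm]
    have hWW : ‖W x‖ ^ 2 = ‖F x‖ ^ 2 - inner ℝ (F x) (b x) + 1 / 4 * ‖b x‖ ^ 2 := by
      simp only [hW, norm_sub_sq_real, inner_smul_right, norm_smul]
      norm_num
      ring
    have hsq : 0 ≤ ‖G x + φ x • W x‖ ^ 2 := sq_nonneg _
    rw [norm_add_sq_real, norm_smul, mul_pow, Real.norm_eq_abs, sq_abs, inner_smul_right] at hsq
    rw [inner_smul_right, hDW, hbW]
    rw [hWW] at hsq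
    have hz := hFZ x
    have hη0x := hη0 x
    have hη1x := hη1 x
    have hρx := hρ0 x
    simp only [hm]
    have hηη : η x ^ 2 ≤ 1 := pow_le_one₀ hη0x hη1x
    set dF := fderiv ℝ η x (F x)
    set db := fderiv ℝ η x (b x)
    set β := ‖b x‖
    set γ := ‖F x‖
    set i := inner ℝ (F x) (b x)
    set j := inner ℝ (G x) (W x)
    set p := φ x
    set e := η x
    set g := ‖G x‖
    set dv := divergence F x
    -- The drift is unbounded, so the cutoff term `η ∂_b η` has no uniform bound of its own; the
    -- spare `|b|²/4` absorbs it at the cost of `D²`. For the bounded `F` the plain bound `D M`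
    -- suffices.
    have key1 : e * |db| ≤ 1 / 4 * e ^ 2 * β ^ 2 + D ^ 2 := by
      nlinarith [mul_le_mul_of_nonneg_left hdb1 hη0x, sq_nonneg (1 / 2 * e * β - D)]
    have key2 : e * |dF| ≤ D * M := (mul_le_of_le_one_left (abs_nonneg _) hη1x).trans hdF1
    have key1' : -(e * db) ≤ 1 / 4 * e ^ 2 * β ^ 2 + D ^ 2 :=
      le_trans (by rw [← mul_neg]; exact mul_le_mul_of_nonneg_left (neg_le_abs _) hη0x) key1
    have key1'' : (e * db) ≤ 1 / 4 * e ^ 2 * β ^ 2 + D ^ 2 :=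
      le_trans (mul_le_mul_of_nonneg_left (le_abs_self _) hη0x) key1
    have key2' : -(e * dF) ≤ D * M :=
      le_trans (by rw [← mul_neg]; exact mul_le_mul_of_nonneg_left (neg_le_abs _) hη0x) key2
    have h1 : e ^ 2 * g ^ 2 ≤ g ^ 2 := mul_le_of_le_one_left (sq_nonneg _) hηη
    have h2 : τ / 2 * (e ^ 2 * p ^ 2) ≤ τ / 2 * p ^ 2 :=
      mul_le_mul_of_nonneg_left (mul_le_of_le_one_left (sq_nonneg _) hηη) (by positivity)
    have h3 : e ^ 2 * p ^ 2 * Z x ≤ e ^ 2 * p ^ 2 * (dv - γ ^ 2) :=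
      mul_le_mul_of_nonneg_left hz (by positivity)
    have h4 : 0 ≤ e ^ 2 * (g ^ 2 + 2 * (p * j) + p ^ 2 * (γ ^ 2 - i + 1 / 4 * β ^ 2)) :=
      mul_nonneg (sq_nonneg _) hsq
    have h5 : p ^ 2 * (-(2 * (e * dF)) + e * db) ≤
        p ^ 2 * (1 / 4 * e ^ 2 * β ^ 2 + D ^ 2 + 2 * (D * M)) :=
      mul_le_mul_of_nonneg_left (by linarith) (sq_nonneg _)
    have main : e ^ 2 * (Z x * p ^ 2) ≤ g ^ 2 + (τ / 2 + (D ^ 2 + 2 * D * M)) * p ^ 2 +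
        (p ^ 2 * (e ^ 2 * (dv - τ / 2) - e ^ 2 * (i - 1 / 2 * β ^ 2) +
          2 * e * (dF - 1 / 2 * db)) + 2 * (p * (e ^ 2 * j))) := by
      linarith
    have := mul_le_mul_of_nonneg_left main hρx.le
    linarith
  have i4 : Integrable fun x => φ x ^ 2 * divergence (fun x => m x • W x) x +
      2 * (φ x * inner ℝ (G x) (m x • W x)) := i1.add (i2.const_mul 2)
  have i5 : Integrable fun x => ρ x * ‖G x‖ ^ 2 +
      (τ / 2 + (D ^ 2 + 2 * D * M)) * (ρ x * φ x ^ 2) := iG.add (iφ.const_mul _)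
  have h := integral_mono i3 (i5.add i4) hpt
  simp only [Pi.add_apply] at h
  rw [integral_add i5 i4, integral_add i1 (i2.const_mul 2), integral_const_mul, hibp,
    integral_add iG (iφ.const_mul _), integral_const_mul] at h
  linarith

/-- Stretching the cutoff by `1 / s k` makes its gradient at most `s k * C`, so the errors
containing `D` vanish; boundedness of `Z` gives the dominating function on the left. -/
theorem MemH1.integral_mul_sq_le (hρ : ContDiff ℝ 1 ρ) (hρ0 : ∀ x, 0 < ρ x)
    (hb : ContDiff ℝ 1 b) (hρb : ∀ x v, fderiv ℝ ρ x v = -(ρ x * inner ℝ (b x) v))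
    (hτ : ∀ x, divergence b x = τ) (hτ0 : 0 ≤ τ)
    (hφ : MemH1 (volume.withDensity fun x => ENNReal.ofReal (ρ x)) φ G)
    (hF : ContDiff ℝ 1 F) (hFM : ∀ x, ‖F x‖ ≤ M) (hZ : Continuous Z) {B : ℝ}
    (hZB : ∀ x, |Z x| ≤ B) (hFZ : ∀ x, Z x ≤ divergence F x - ‖F x‖ ^ 2) :
    ∫ x, Z x * φ x ^ 2 ∂(volume.withDensity fun x => ENNReal.ofReal (ρ x)) ≤
      ∫ x, ‖G x‖ ^ 2 ∂(volume.withDensity fun x => ENNReal.ofReal (ρ x)) +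
        τ / 2 * ∫ x, φ x ^ 2 ∂(volume.withDensity fun x => ENNReal.ofReal (ρ x)) := by
  rw [integral_withDensity_ofReal hρ.continuous.measurable fun x => (hρ0 x).le,
    integral_withDensity_ofReal hρ.continuous.measurable fun x => (hρ0 x).le,
    integral_withDensity_ofReal hρ.continuous.measurable fun x => (hρ0 x).le]
  have iφ : Integrable fun x => ρ x * φ x ^ 2 :=
    (integrable_withDensity_ofReal_iff hρ.continuous.measurable fun x => (hρ0 x).le).1
      hφ.memLp.integrable_sq
  let θ : ContDiffBump (0 : EuclideanSpace ℝ (Fin N)) := ⟨1, 2, one_pos, one_lt_two⟩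
  have hθ : ContDiff ℝ 1 (θ : EuclideanSpace ℝ (Fin N) → ℝ) := θ.contDiff
  obtain ⟨C, hC⟩ := (θ.hasCompactSupport.fderiv ℝ).exists_bound_of_continuous
    (hθ.continuous_fderiv one_ne_zero)
  let s : ℕ → ℝ := fun k => 1 / ((k : ℝ) + 1)
  have hs : Tendsto s atTop (𝓝 0) := tendsto_one_div_add_atTop_nhds_zero_nat
  have hs0 : ∀ k, 0 < s k := fun k => by positivity
  have hstep : ∀ k, ∫ x, ρ x * (θ (s k • x) ^ 2 * (Z x * φ x ^ 2)) ≤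
      (∫ x, ρ x * ‖G x‖ ^ 2) +
        (τ / 2 + ((s k * C) ^ 2 + 2 * (s k * C) * M)) * ∫ x, ρ x * φ x ^ 2 := by
    intro k
    refine integral_cutoff_mul_sq_le hρ hρ0 hb hρb hτ hτ0 hφ hF hFM hZ hFZ
      (η := fun x => θ (s k • x)) (hθ.comp (contDiff_const_smul _))
      (θ.hasCompactSupport.comp_smul (hs0 k).ne') (fun x => θ.nonneg) (fun x => θ.le_one)
      fun x => ?_
    have h1 : HasFDerivAt (fun x => θ (s k • x)) ((fderiv ℝ θ (s k • x)).comp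
        (s k • ContinuousLinearMap.id ℝ _)) x :=
      (hθ.differentiable one_ne_zero _).hasFDerivAt.comp x ((hasFDerivAt_id x).const_smul (s k))
    rw [h1.fderiv, ContinuousLinearMap.comp_smul, ContinuousLinearMap.comp_id, norm_smul,
      Real.norm_of_nonneg (hs0 k).le]
    exact mul_le_mul_of_nonneg_left (hC _) (hs0 k).le
  have hlimR : Tendsto (fun k => (∫ x, ρ x * ‖G x‖ ^ 2) +
      (τ / 2 + ((s k * C) ^ 2 + 2 * (s k * C) * M)) * ∫ x, ρ x * φ x ^ 2) atTop
      (𝓝 ((∫ x, ρ x * ‖G x‖ ^ 2) +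
      (τ / 2 + ((0 * C) ^ 2 + 2 * (0 * C) * M)) * ∫ x, ρ x * φ x ^ 2)) := by
    have h1 := hs.mul_const C
    exact tendsto_const_nhds.add ((tendsto_const_nhds.add
      ((h1.pow 2).add ((h1.const_mul 2).mul_const M))).mul_const _)
  have hlimL : Tendsto (fun k => ∫ x, ρ x * (θ (s k • x) ^ 2 * (Z x * φ x ^ 2))) atTop
      (𝓝 (∫ x, ρ x * (Z x * φ x ^ 2))) := by
    have hφm : AEStronglyMeasurable φ := hφ.hasWeakGradient.1.aestronglyMeasurable
    refine tendsto_integral_of_dominated_convergence (fun x => B * (ρ x * φ x ^ 2)) (fun k => ?_)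
      (iφ.const_mul B) (fun k => Eventually.of_forall fun x => ?_)
      (Eventually.of_forall fun x => ?_)
    · exact hρ.continuous.aestronglyMeasurable.mul
        (((hθ.continuous.comp (continuous_const_smul _)).pow 2).aestronglyMeasurable.mul
          (hZ.aestronglyMeasurable.mul (hφm.pow 2)))
    · rw [norm_mul, norm_mul, norm_mul, Real.norm_of_nonneg (hρ0 x).le,
        Real.norm_of_nonneg (sq_nonneg (φ x)), Real.norm_of_nonneg (sq_nonneg (θ (s k • x)))]
      have h1 : θ (s k • x) ^ 2 ≤ 1 := pow_le_one₀ θ.nonneg θ.le_one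
      have h2 := hZB x
      rw [← Real.norm_eq_abs] at h2
      have h3 : 0 ≤ ‖Z x‖ * φ x ^ 2 := by positivity
      calc _ ≤ ρ x * (‖Z x‖ * φ x ^ 2) :=
            mul_le_mul_of_nonneg_left (mul_le_of_le_one_left h3 h1) (hρ0 x).le
        _ = ‖Z x‖ * (ρ x * φ x ^ 2) := by ring
        _ ≤ _ := mul_le_mul_of_nonneg_right h2 (mul_nonneg (hρ0 x).le (sq_nonneg _))
    · have h1 : Tendsto (fun k => θ (s k • x)) atTop (𝓝 (θ ((0 : ℝ) • x))) :=
        (hθ.continuous.tendsto _).comp (hs.smul_const x)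
      have h2 : θ ((0 : ℝ) • x) = 1 := by
        rw [zero_smul]
        exact θ.one_of_mem_closedBall (mem_closedBall_self zero_le_one)
      rw [h2] at h1
      simpa using ((h1.pow 2).mul_const (Z x * φ x ^ 2)).const_mul (ρ x)
  have := le_of_tendsto_of_tendsto' hlimL hlimR hstep
  simpa using this

end WeightedHardy

/-! ### Radial profiles, and the interaction of distant poles. -/

section MultipolarField

open Filter
open scoped Topology

theorem hasDerivAt_max_zero_sq (z : ℝ) :
    HasDerivAt (fun y : ℝ => max y 0 ^ 2) (2 * max z 0) z := by
  rcases lt_trichotomy z 0 with hz | rfl | hz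
  · rw [max_eq_right hz.le, mul_zero]
    refine (hasDerivAt_const z (0 : ℝ)).congr_of_eventuallyEq ?_
    filter_upwards [eventually_lt_nhds hz] with y hy
    simp [max_eq_right hy.le]
  · rw [max_self, mul_zero, hasDerivAt_iff_isLittleO_nhds_zero]
    simp only [zero_add, max_self, smul_zero, sub_zero, ne_eq, OfNat.ofNat_ne_zero,
      not_false_eq_true, zero_pow]
    have h : (fun y : ℝ => y ^ 2) =o[𝓝 0] fun y => y := by
      simpa using (Asymptotics.isLittleO_pow_id (n := 2) one_lt_two (𝕜 := ℝ))
    refine Asymptotics.IsBigO.trans_isLittleO (.of_bound 1 (Eventually.of_forall fun y => ?_)) h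
    rw [one_mul, norm_pow, norm_pow]
    refine pow_le_pow_left₀ (norm_nonneg _) ?_ 2
    rw [Real.norm_eq_abs, Real.norm_eq_abs, abs_of_nonneg (le_max_right _ _)]
    exact max_le (le_abs_self y) (abs_nonneg y)
  · rw [max_eq_left hz.le]
    have h : HasDerivAt (fun y : ℝ => y ^ 2) (2 * z) z := by simpa using hasDerivAt_pow 2 z
    refine h.congr_of_eventuallyEq ?_
    filter_upwards [eventually_gt_nhds hz] with y hy
    simp [max_eq_left hy.le]

/-- The truncated square `(1 - q)₊²`. -/
noncomputable def truncSq (q : ℝ) : ℝ := max (1 - q) 0 ^ 2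

theorem hasDerivAt_truncSq (q : ℝ) : HasDerivAt truncSq (-(2 * max (1 - q) 0)) q := by
  have h : HasDerivAt truncSq _ q :=
    (hasDerivAt_max_zero_sq (1 - q)).comp q ((hasDerivAt_id q).const_sub 1)
  exact h.congr_deriv (by simp)

theorem contDiff_truncSq : ContDiff ℝ 1 truncSq := by
  rw [contDiff_one_iff_deriv]
  refine ⟨fun q => (hasDerivAt_truncSq q).differentiableAt, ?_⟩
  have : deriv truncSq = fun q => -(2 * max (1 - q) 0) :=
    funext fun q => (hasDerivAt_truncSq q).deriv
  rw [this]
  fun_prop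

theorem truncSq_of_one_le {q : ℝ} (hq : 1 ≤ q) : truncSq q = 0 := by
  simp [truncSq, max_eq_right (sub_nonpos.2 hq)]

theorem truncSq_of_le_one {q : ℝ} (hq : q ≤ 1) : truncSq q = (1 - q) ^ 2 := by
  simp [truncSq, max_eq_left (sub_nonneg.2 hq)]

theorem truncSq_nonneg (q : ℝ) : 0 ≤ truncSq q := sq_nonneg _

theorem truncSq_lt_one {q : ℝ} (hq : 0 < q) : truncSq q < 1 := by
  rcases le_total 1 q with h | h
  · simp [truncSq_of_one_le h]
  · rw [truncSq_of_le_one h]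
    nlinarith

/-- The radial profile of the field of a single pole, as a function of the squared distance. -/
noncomputable def poleProfile (s q : ℝ) : ℝ := (s + (1 - s) * truncSq q) / q

/-- The factor by which the fields of the other poles are damped near a pole, as a function of the
squared distance to that pole. -/
noncomputable def poleDamping (α q : ℝ) : ℝ := (1 - truncSq q) ^ α

theorem hasDerivAt_poleProfile (s : ℝ) {q : ℝ} (hq : q ≠ 0) :
    HasDerivAt (poleProfile s)
      (-(2 * (1 - s) * max (1 - q) 0) / q - (s + (1 - s) * truncSq q) / q ^ 2) q := by
  have h := (((hasDerivAt_truncSq q).const_mul (1 - s)).const_add s).div (hasDerivAt_id q) hq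
  refine h.congr_deriv ?_
  simp only [id]
  field_simp

theorem hasDerivAt_poleDamping (α : ℝ) {q : ℝ} (hq : 0 < q) :
    HasDerivAt (poleDamping α)
      (2 * max (1 - q) 0 * α * (1 - truncSq q) ^ (α - 1)) q := by
  have h := ((hasDerivAt_truncSq q).const_sub 1).rpow_const (p := α)
    (Or.inl (sub_pos.2 (truncSq_lt_one hq)).ne')
  refine h.congr_deriv ?_
  ring

theorem poleDamping_of_one_le (α : ℝ) {q : ℝ} (hq : 1 ≤ q) : poleDamping α q = 1 := by
  simp [poleDamping, truncSq_of_one_le hq]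

theorem poleDamping_nonneg (α : ℝ) {q : ℝ} (hq : 0 < q) : 0 ≤ poleDamping α q :=
  Real.rpow_nonneg (sub_pos.2 (truncSq_lt_one hq)).le _

theorem poleDamping_le_one {α : ℝ} (hα : 0 ≤ α) {q : ℝ} (hq : 0 < q) : poleDamping α q ≤ 1 :=
  Real.rpow_le_one (sub_pos.2 (truncSq_lt_one hq)).le
    (sub_le_self _ (truncSq_nonneg q)) hα

variable {E : Type*} [NormedAddCommGroup E] [InnerProductSpace ℝ E]

/-- Interaction bound for poles at mutual distance at least `2`. -/
theorem norm_sum_inv_smul_sq_le {ι : Type*} (S : Finset ι) (x : ι → E) (q : ι → ℝ)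
    (hq : ∀ i ∈ S, 1 ≤ q i) (hxq : ∀ i ∈ S, ‖x i‖ ^ 2 ≤ q i)
    (hx : ∀ i ∈ S, ∀ j ∈ S, i ≠ j → 2 ≤ ‖x i - x j‖) :
    ‖∑ i ∈ S, (q i)⁻¹ • x i‖ ^ 2 ≤
      (S.card + 2) * (∑ i ∈ S, (q i)⁻¹) - 2 * (∑ i ∈ S, (q i)⁻¹) ^ 2 := by
  classical
  set B := ∑ i ∈ S, (q i)⁻¹ with hB
  have h1 : ‖∑ i ∈ S, (q i)⁻¹ • x i‖ ^ 2 =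
      ∑ i ∈ S, ∑ j ∈ S, (q i)⁻¹ * ((q j)⁻¹ * inner ℝ (x i) (x j)) := by
    rw [← real_inner_self_eq_norm_sq, sum_inner]
    refine Finset.sum_congr rfl fun i _ => ?_
    rw [inner_sum]
    refine Finset.sum_congr rfl fun j _ => ?_
    rw [real_inner_smul_left, real_inner_smul_right]
  -- Off the diagonal, polarization and `‖x i - x j‖ ≥ 2` give `⟨x i, x j⟩ ≤ (q i + q j)/2 - 2`. On
  -- the diagonal the distance is `0`, and the extra `2 / q i` repairs the bound.
  have h2 : ∀ i ∈ S, ∀ j ∈ S, (q i)⁻¹ * ((q j)⁻¹ * inner ℝ (x i) (x j)) ≤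
      ((q i)⁻¹ + (q j)⁻¹) / 2 - 2 * ((q i)⁻¹ * (q j)⁻¹) + if i = j then 2 * (q i)⁻¹ else 0 := by
    intro i hi j hj
    have qi := hq i hi
    have qj := hq j hj
    have hqi : 0 < q i := by linarith
    have hqj : 0 < q j := by linarith
    have e : ((q i)⁻¹ + (q j)⁻¹) / 2 - 2 * ((q i)⁻¹ * (q j)⁻¹) =
        ((q i)⁻¹ * (q j)⁻¹) * ((q i + q j) / 2 - 2) := by
      field_simp
      ring
    have hpos : 0 ≤ (q i)⁻¹ * (q j)⁻¹ := by positivity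
    rw [e, ← mul_assoc]
    split_ifs with hij
    · subst hij
      have h3 : (q i)⁻¹ * (q i)⁻¹ ≤ (q i)⁻¹ :=
        mul_le_of_le_one_left (by positivity) (inv_le_one_of_one_le₀ qi)
      have h4 : (q i)⁻¹ * (q i)⁻¹ * inner ℝ (x i) (x i) ≤ (q i)⁻¹ * (q i)⁻¹ * q i := by
        rw [real_inner_self_eq_norm_sq]
        exact mul_le_mul_of_nonneg_left (hxq i hi) hpos
      linarith
    · rw [add_zero]
      refine mul_le_mul_of_nonneg_left ?_ hpos
      have h5 := norm_sub_sq_real (x i) (x j)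
      have h6 := hx i hi j hj hij
      have := hxq i hi
      have := hxq j hj
      nlinarith
  rw [h1]
  refine (Finset.sum_le_sum fun i hi => Finset.sum_le_sum fun j hj => h2 i hi j hj).trans
    (le_of_eq ?_)
  simp only [Finset.sum_add_distrib, Finset.sum_sub_distrib, ← Finset.mul_sum, Finset.sum_ite_eq,
    ← Finset.sum_div, Finset.sum_const, nsmul_eq_mul, Finset.sum_ite_mem, Finset.inter_self,
    ← Finset.sum_mul, ← hB]
  ring

/-- Termwise polarization: `2 ⟨x₀, x i⟩ ≤ q₀ + q i - 4`, divided by `q i`. -/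
theorem two_mul_inner_sum_le {ι : Type*} (S : Finset ι) (x : ι → E) (q : ι → ℝ) (x₀ : E) (q₀ : ℝ)
    (hq : ∀ i ∈ S, 1 ≤ q i) (hxq : ∀ i ∈ S, ‖x i‖ ^ 2 ≤ q i) (hx₀ : ‖x₀‖ ^ 2 ≤ q₀)
    (hx : ∀ i ∈ S, 2 ≤ ‖x₀ - x i‖) :
    2 * inner ℝ x₀ (∑ i ∈ S, (q i)⁻¹ • x i) ≤ S.card - (4 - q₀) * ∑ i ∈ S, (q i)⁻¹ := by
  rw [inner_sum, Finset.mul_sum, Finset.mul_sum, Finset.cast_card, ← Finset.sum_sub_distrib]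
  refine Finset.sum_le_sum fun i hi => ?_
  have hqi : 0 < q i := by linarith [hq i hi]
  have h5 := norm_sub_sq_real x₀ (x i)
  have h6 := hx i hi
  have h7 := hxq i hi
  have e : 1 - (4 - q₀) * (q i)⁻¹ = (q i)⁻¹ * (q i - (4 - q₀)) := by field_simp
  rw [real_inner_smul_right, e, mul_left_comm]
  refine mul_le_mul_of_nonneg_left ?_ (by positivity)
  nlinarith

end MultipolarField

/-! ### The scalar inequalities that fix the profile parameter. -/

section ScalarInequalities

/-- After inserting the bound on `U` the claim is a quadratic in `V` whose coefficients are affine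
in `n`, so it is enough that it is positive at `n = 2` and `n = 9`. -/
theorem few_poles_outer_bound {n V U : ℝ} (hn2 : 2 ≤ n) (hn : n ≤ 9)
    (hU : U ≤ (n + 2) * V - 2 * V ^ 2) :
    V - (n + 1) ≤ 2 * (3 / 4) * V - (3 / 4) ^ 2 * U := by
  nlinarith [mul_nonneg (sub_nonneg.2 hn2) (sq_nonneg (V - 5 / 2)),
    mul_nonneg (sub_nonneg.2 hn) (sq_nonneg (V - 1 / 2)), sq_nonneg (V - 5 / 2),
    sq_nonneg (V - 1 / 2)]

/-- The terms in `q` and `β` cost at most `2`. With `χ² ≤ χ` the rest is bounded by an expression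
affine in `χ`, so only `χ = 0` and `χ = 1` matter; the first is `B ≤ n - 1`. -/
theorem few_poles_inner_bound {n q B χ m y w β : ℝ} (hn2 : 2 ≤ n) (hn : n ≤ 9) (hq0 : 0 < q)
    (hq1 : q ≤ 1) (hB : 0 ≤ B) (hBn : B ≤ n - 1) (hχ0 : 0 ≤ χ) (hχ1 : χ ≤ 1) (hm0 : 0 ≤ m)
    (hm : m ≤ 3 / 4) (hβ : β ≤ 2) (hy : 2 * y ≤ (n - 1) - (4 - q) * B) (hw0 : 0 ≤ w)
    (hw : w ≤ (n + 1) * B - 2 * B ^ 2) :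
    (1 - 3 / 4) ^ 2 * (q * (2 - q) ^ 2) + 4 * β * (1 - 3 / 4) * (1 - q) + B - 2 * (3 / 4) * χ * B +
      2 * (3 / 4) * χ * m * y + (3 / 4) ^ 2 * χ ^ 2 * w ≤ n + 1 := by
  have hT : (1 - 3 / 4) ^ 2 * (q * (2 - q) ^ 2) + 4 * β * (1 - 3 / 4) * (1 - q) ≤ (2 : ℝ) := by
    have h1 : β * (1 - q) ≤ 2 * (1 - q) := mul_le_mul_of_nonneg_right hβ (by linarith)
    have h2 : (2 - q) ^ 2 ≤ 4 := by nlinarith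
    have h3 : q * (2 - q) ^ 2 ≤ q * 4 := mul_le_mul_of_nonneg_left h2 hq0.le
    nlinarith
  have hχw : χ ^ 2 * w ≤ χ * w :=
    mul_le_mul_of_nonneg_right (by nlinarith) hw0
  have hy' : 2 * y ≤ (n - 1) - 3 * B := by nlinarith
  -- `z` replaces the cross term by a bound free of `m` and `y`. The sign of `(n - 1) - 3 B` decides
  -- whether `m = 0` or `m = 3/4` is the worst case.
  obtain ⟨z, hz, hz2⟩ : ∃ z, 2 * (3 / 4) * (m * y) ≤ z ∧
      2 + B - 2 * (3 / 4) * B + z + (3 / 4) ^ 2 * w ≤ n + 1 := by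
    rcases le_total ((n - 1) - 3 * B) 0 with h | h
    · refine ⟨0, ?_, ?_⟩
      · have : m * y ≤ 0 := mul_nonpos_of_nonneg_of_nonpos hm0 (by linarith)
        linarith
      · nlinarith [mul_nonneg (sub_nonneg.2 hn2) (sq_nonneg (B - 2)),
          mul_nonneg (sub_nonneg.2 hn) (sq_nonneg (B - 1 / 2)), sq_nonneg (B - 2),
          sq_nonneg (B - 1 / 2)]
    · refine ⟨9 / 16 * ((n - 1) - 3 * B), ?_, ?_⟩
      · have h1 : m * (2 * y) ≤ m * ((n - 1) - 3 * B) := mul_le_mul_of_nonneg_left hy' hm0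
        have h2 : m * ((n - 1) - 3 * B) ≤ 3 / 4 * ((n - 1) - 3 * B) :=
          mul_le_mul_of_nonneg_right hm h
        linarith
      · nlinarith [mul_nonneg (sub_nonneg.2 hn2) (sq_nonneg (B - 3 / 2)),
          mul_nonneg (sub_nonneg.2 hn) (sq_nonneg B), sq_nonneg (B - 3 / 2), sq_nonneg B]
  have hconv : 2 + B + χ * (-(2 * (3 / 4)) * B + z + (3 / 4) ^ 2 * w) ≤ n + 1 := by
    nlinarith
  nlinarith [mul_le_mul_of_nonneg_left hz hχ0]

/-- Multiply by `(2 - r)²`. As this factor is at least `1`, the case `n = 10` is the worst, and it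
is a polynomial inequality on `[0, 1]`. The analogue for `n = 9` fails for small `r`, hence the
separate treatment of few poles. -/
theorem many_poles_inner_bound {n q r B β : ℝ} (hn : 10 ≤ n) (hr0 : 0 ≤ r) (hr1 : r ≤ 1)
    (hqr : q = r ^ 2) (hβ : β ≤ 2) (hB : B * (2 - r) ^ 2 ≤ n - 1) :
    q * (2 - q) ^ 2 + 4 * β * (1 - q) + B ≤ n + 1 := by
  have hq1 : q ≤ 1 := by nlinarith
  have h1 : β * (1 - q) ≤ 2 * (1 - q) := mul_le_mul_of_nonneg_right hβ (by linarith)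
  have h2 : 1 ≤ (2 - r) ^ 2 := by nlinarith
  suffices h : 9 ≤ (3 + 8 * q - q * (2 - q) ^ 2) * (2 - r) ^ 2 by
    have h3 : (n - 10) * 1 ≤ (n - 10) * (2 - r) ^ 2 := mul_le_mul_of_nonneg_left h2 (by linarith)
    have h4 : B * (2 - r) ^ 2 ≤ (n - 7 + 8 * q - q * (2 - q) ^ 2) * (2 - r) ^ 2 := by nlinarith
    have h5 := le_of_mul_le_mul_right h4 (by linarith)
    linarith
  have h6 : 3 + 4 * r ^ 2 + 3 * r ^ 4 ≤ 3 + 8 * q - q * (2 - q) ^ 2 := by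
    have : r ^ 6 ≤ r ^ 4 := pow_le_pow_of_le_one hr0 hr1 (by norm_num)
    rw [hqr]
    nlinarith
  refine le_trans ?_ (mul_le_mul_of_nonneg_right h6 (sq_nonneg _))
  nlinarith [mul_nonneg hr0 (sub_nonneg.2 hr1), sq_nonneg (r - 1 / 2), sq_nonneg (r ^ 2 - 1 / 4),
    mul_nonneg hr0 (sq_nonneg (r - 1 / 2)), sq_nonneg (r * (r - 1 / 2)),
    mul_nonneg (mul_nonneg hr0 (sub_nonneg.2 hr1)) (sq_nonneg (r - 1 / 2)), sq_nonneg (r ^ 2 - r / 2),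
    mul_nonneg (mul_nonneg hr0 (sub_nonneg.2 hr1)) (sq_nonneg (r ^ 2))]

end ScalarInequalities

/-! ### The multipolar field and its pointwise estimate. -/

section MultipolarField

open Filter
open scoped Topology

variable {N n : ℕ}

/-- The regularized squared distance to a pole. -/
noncomputable def sqDist (ε : ℝ) (a x : EuclideanSpace ℝ (Fin N)) : ℝ := ‖x - a‖ ^ 2 + ε ^ 2

theorem sqDist_pos {ε : ℝ} (hε : 0 < ε) (a x : EuclideanSpace ℝ (Fin N)) : 0 < sqDist ε a x := by
  unfold sqDist
  positivity

theorem contDiff_sqDist (ε : ℝ) (a : EuclideanSpace ℝ (Fin N)) : ContDiff ℝ ∞ (sqDist ε a) :=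
  ((contDiff_id.sub contDiff_const).norm_sq ℝ).add contDiff_const

theorem hasFDerivAt_sqDist (ε : ℝ) (a x : EuclideanSpace ℝ (Fin N)) :
    HasFDerivAt (sqDist ε a) ((2 : ℝ) • innerSL ℝ (x - a)) x := by
  have h := (((hasFDerivAt_id x).sub_const a).norm_sq).add_const (ε ^ 2)
  refine h.congr_fderiv ?_
  ext v
  simp

/-- The weight of the field of the `i`-th pole: it is `1` away from the other poles. -/
noncomputable def poleWeight (α ε : ℝ) (b : Fin n → EuclideanSpace ℝ (Fin N)) (i : Fin n)
    (x : EuclideanSpace ℝ (Fin N)) : ℝ :=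
  1 - ∑ j ∈ Finset.univ.erase i, (1 - poleDamping α (sqDist ε (b j) x))

/-- A regularized vector field adapted to several poles. -/
noncomputable def multipolarField (s α ε : ℝ) (b : Fin n → EuclideanSpace ℝ (Fin N))
    (x : EuclideanSpace ℝ (Fin N)) : EuclideanSpace ℝ (Fin N) :=
  ∑ i, poleWeight α ε b i x • (poleProfile s (sqDist ε (b i) x) • (x - b i))

variable {s α ε : ℝ} {b : Fin n → EuclideanSpace ℝ (Fin N)}

theorem contDiff_poleProfile_sqDist (s : ℝ) (hε : 0 < ε) (a : EuclideanSpace ℝ (Fin N)) :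
    ContDiff ℝ 1 fun x => poleProfile s (sqDist ε a x) := by
  have hq : ContDiff ℝ 1 (sqDist ε a) := (contDiff_sqDist ε a).of_le (by simp)
  exact (contDiff_const.add (contDiff_const.mul (contDiff_truncSq.comp hq))).div hq
    fun x => (sqDist_pos hε a x).ne'

theorem contDiff_poleDamping_sqDist (α : ℝ) (hε : 0 < ε) (a : EuclideanSpace ℝ (Fin N)) :
    ContDiff ℝ 1 fun x => poleDamping α (sqDist ε a x) := by
  have hq : ContDiff ℝ 1 (sqDist ε a) := (contDiff_sqDist ε a).of_le (by simp)
  exact (contDiff_const.sub (contDiff_truncSq.comp hq)).rpow_const_of_ne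
    fun x => (sub_pos.2 (truncSq_lt_one (sqDist_pos hε a x))).ne'

theorem contDiff_poleWeight (α : ℝ) (hε : 0 < ε) (b : Fin n → EuclideanSpace ℝ (Fin N))
    (i : Fin n) : ContDiff ℝ 1 (poleWeight α ε b i) :=
  contDiff_const.sub (ContDiff.sum fun j _ =>
    contDiff_const.sub (contDiff_poleDamping_sqDist α hε (b j)))

theorem contDiff_multipolarField (s α : ℝ) (hε : 0 < ε) (b : Fin n → EuclideanSpace ℝ (Fin N)) :
    ContDiff ℝ 1 (multipolarField s α ε b) :=
  ContDiff.sum fun i _ => (contDiff_poleWeight α hε b i).smul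
    ((contDiff_poleProfile_sqDist s hε (b i)).smul (contDiff_id.sub contDiff_const))

/-- Only finiteness matters, so a bound that blows up as `ε → 0` is harmless: it multiplies the
gradient of the cutoff and disappears with it. -/
theorem norm_multipolarField_le (hs0 : 0 ≤ s) (hs1 : s ≤ 1) (hα : 0 ≤ α) (hε : 0 < ε)
    (b : Fin n → EuclideanSpace ℝ (Fin N)) (x : EuclideanSpace ℝ (Fin N)) :
    ‖multipolarField s α ε b x‖ ≤ n * ((1 + n) * ε⁻¹) := by
  have h : ∀ i, ‖poleWeight α ε b i x • (poleProfile s (sqDist ε (b i) x) • (x - b i))‖ ≤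
      (1 + n) * ε⁻¹ := by
    intro i
    rw [norm_smul]
    refine mul_le_mul ?_ ?_ (norm_nonneg _) (by positivity)
    · refine (norm_sub_le _ _).trans ?_
      rw [norm_one]
      refine add_le_add_right ((norm_sum_le _ _).trans ?_) 1
      refine (Finset.sum_le_card_nsmul _ _ 1 fun j _ => ?_).trans ?_
      · have h0 := poleDamping_nonneg α (sqDist_pos hε (b j) x)
        have h1 := poleDamping_le_one hα (sqDist_pos hε (b j) x)
        rw [Real.norm_eq_abs, abs_le]
        constructor <;> linarith
      · simp
    · have hq := sqDist_pos hε (b i) x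
      have h0 := truncSq_nonneg (sqDist ε (b i) x)
      have h1 := truncSq_lt_one hq
      rw [norm_smul, poleProfile, norm_div, Real.norm_of_nonneg hq.le,
        Real.norm_of_nonneg (add_nonneg hs0 (mul_nonneg (sub_nonneg.2 hs1) h0)),
        div_mul_eq_mul_div, div_le_iff₀ hq]
      have h2 : s + (1 - s) * truncSq (sqDist ε (b i) x) ≤ 1 := by nlinarith
      refine (mul_le_of_le_one_left (norm_nonneg _) h2).trans ?_
      rw [← div_eq_inv_mul, le_div_iff₀ hε, sqDist]
      nlinarith [sq_nonneg (‖x - b i‖ - ε), norm_nonneg (x - b i)]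
  refine (norm_sum_le _ _).trans ((Finset.sum_le_card_nsmul _ _ _ fun i _ => h i).trans ?_)
  simp

theorem divergence_multipolarField (s α : ℝ) (hε : 0 < ε)
    (b : Fin n → EuclideanSpace ℝ (Fin N)) (x : EuclideanSpace ℝ (Fin N)) :
    divergence (multipolarField s α ε b) x =
      ∑ i, (poleWeight α ε b i x * (N * poleProfile s (sqDist ε (b i) x) +
          2 * deriv (poleProfile s) (sqDist ε (b i) x) * ‖x - b i‖ ^ 2) +
        poleProfile s (sqDist ε (b i) x) * ∑ j ∈ Finset.univ.erase i,
          2 * deriv (poleDamping α) (sqDist ε (b j) x) * inner ℝ (x - b j) (x - b i)) := by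
  have hP : ∀ i, DifferentiableAt ℝ (fun x => poleProfile s (sqDist ε (b i) x)) x := fun i =>
    (contDiff_poleProfile_sqDist s hε (b i)).differentiable one_ne_zero x
  have hw : ∀ i, DifferentiableAt ℝ (poleWeight α ε b i) x := fun i =>
    (contDiff_poleWeight α hε b i).differentiable one_ne_zero x
  have hx : ∀ i, DifferentiableAt ℝ (fun x => x - b i) x := fun i => by fun_prop
  have hPx : ∀ i, DifferentiableAt ℝ
      (fun x => poleProfile s (sqDist ε (b i) x) • (x - b i)) x := fun i => (hP i).smul (hx i)
  have hwPx : ∀ i, DifferentiableAt ℝ (fun x => poleWeight α ε b i x •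
      (poleProfile s (sqDist ε (b i) x) • (x - b i))) x := fun i => (hw i).smul (hPx i)
  unfold multipolarField
  rw [divergence_sum _ fun i _ => hwPx i]
  refine Finset.sum_congr rfl fun i _ => ?_
  have hdP : ∀ v, fderiv ℝ (fun x => poleProfile s (sqDist ε (b i) x)) x v =
      2 * deriv (poleProfile s) (sqDist ε (b i) x) * inner ℝ (x - b i) v := by
    intro v
    have h1 := (hasDerivAt_poleProfile s (sqDist_pos hε (b i) x).ne').differentiableAt.hasDerivAt
    have h2 := h1.comp_hasFDerivAt x (hasFDerivAt_sqDist ε (b i) x)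
    have h3 := congrArg (fun L => L v) h2.fderiv
    refine h3.trans ?_
    simp only [smul_apply, smul_eq_mul, innerSL_apply_apply]
    ring
  have hdχ : ∀ j, HasFDerivAt (fun x => poleDamping α (sqDist ε (b j) x))
      (deriv (poleDamping α) (sqDist ε (b j) x) • ((2 : ℝ) • innerSL ℝ (x - b j))) x := by
    intro j
    have h1 := (hasDerivAt_poleDamping α (sqDist_pos hε (b j) x)).differentiableAt.hasDerivAt
    exact h1.comp_hasFDerivAt x (hasFDerivAt_sqDist ε (b j) x)
  have hdw : ∀ v, fderiv ℝ (poleWeight α ε b i) x v = ∑ j ∈ Finset.univ.erase i,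
      2 * deriv (poleDamping α) (sqDist ε (b j) x) * inner ℝ (x - b j) v := by
    intro v
    have h1 : HasFDerivAt (poleWeight α ε b i) _ x :=
      (HasFDerivAt.fun_sum (u := Finset.univ.erase i) fun j _ => (hdχ j).const_sub 1).const_sub 1
    rw [h1.fderiv]
    simp only [Finset.sum_neg_distrib, neg_neg, sum_apply, smul_apply,
      smul_eq_mul, innerSL_apply_apply]
    refine Finset.sum_congr rfl fun j _ => ?_
    ring
  rw [divergence_smul (hw i) (hPx i), divergence_smul (hP i) (hx i),
    divergence_id_sub, hdP, hdw, real_inner_self_eq_norm_sq]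
  rw [Finset.mul_sum]
  congr 1
  · ring
  · refine Finset.sum_congr rfl fun j _ => ?_
    rw [real_inner_smul_right]
    ring

theorem poleProfile_of_one_le (s : ℝ) {q : ℝ} (hq : 1 ≤ q) : poleProfile s q = s * q⁻¹ := by
  simp [poleProfile, truncSq_of_one_le hq, div_eq_mul_inv]

theorem deriv_poleProfile_of_one_le (s : ℝ) {q : ℝ} (hq : 1 ≤ q) :
    deriv (poleProfile s) q = -(s * (q⁻¹ * q⁻¹)) := by
  rw [(hasDerivAt_poleProfile s (by linarith : q ≠ 0)).deriv, truncSq_of_one_le hq,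
    max_eq_right (sub_nonpos.2 hq)]
  field_simp
  ring

theorem deriv_poleDamping_of_one_le (α : ℝ) {q : ℝ} (hq : 1 ≤ q) :
    deriv (poleDamping α) q = 0 := by
  rw [(hasDerivAt_poleDamping α (by linarith : 0 < q)).deriv, max_eq_right (sub_nonpos.2 hq)]
  simp

theorem sq_norm_le_sqDist (ε : ℝ) (a x : EuclideanSpace ℝ (Fin N)) :
    ‖x - a‖ ^ 2 ≤ sqDist ε a x := le_add_of_nonneg_right (sq_nonneg ε)

/-- A single far pole contributes at least the flux of the unregularized field. -/
theorem far_pole_divergence_le {q r : ℝ} (hq : 0 < q) (hr : r ^ 2 ≤ q) (hs0 : 0 ≤ s) (M : ℝ) :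
    s * (M - 2) * q⁻¹ ≤ M * (s * q⁻¹) + 2 * (-(s * (q⁻¹ * q⁻¹))) * r ^ 2 := by
  have h : q⁻¹ * q⁻¹ * r ^ 2 ≤ q⁻¹ := by
    calc q⁻¹ * q⁻¹ * r ^ 2 ≤ q⁻¹ * q⁻¹ * q := by gcongr
      _ = q⁻¹ := by field_simp
  nlinarith [mul_le_mul_of_nonneg_left h hs0]

/-- No truncation or damping is active here, so the field is `s ∑ (x - bᵢ)/qᵢ`. For `s = 0` it
vanishes and `V ≤ n` is enough; for `s = 3/4` the interaction bound feeds `few_poles_outer_bound`.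
-/
theorem multipolarField_estimate_far (hN : 3 ≤ N) (hn2 : 2 ≤ n) (hε : 0 < ε)
    (hb : ∀ i j, i ≠ j → 2 ≤ ‖b i - b j‖) (hs : (s = 3 / 4 ∧ n ≤ 9) ∨ (s = 0 ∧ 10 ≤ n))
    (hα : α = ((N : ℝ) - 2) / 2) (x : EuclideanSpace ℝ (Fin N))
    (hx : ∀ i, 1 ≤ sqDist ε (b i) x) :
    ∑ i, (sqDist ε (b i) x)⁻¹ - (n + 1) ≤
      α⁻¹ * divergence (multipolarField s α ε b) x - ‖multipolarField s α ε b x‖ ^ 2 := by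
  have hN' : (3 : ℝ) ≤ N := by exact_mod_cast hN
  have hn2' : (2 : ℝ) ≤ n := by exact_mod_cast hn2
  have hα0 : 0 < α := by rw [hα]; linarith
  have hs0 : 0 ≤ s := by rcases hs with h | h <;> rw [h.1]; norm_num
  set V := ∑ i, (sqDist ε (b i) x)⁻¹ with hV
  have hV0 : 0 ≤ V := Finset.sum_nonneg fun i _ => inv_nonneg.2 (sqDist_pos hε (b i) x).le
  have hVn : V ≤ n := by
    refine (Finset.sum_le_card_nsmul _ _ 1 fun i _ => inv_le_one_of_one_le₀ (hx i)).trans ?_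
    simp
  have hw : ∀ i, poleWeight α ε b i x = 1 := fun i => by
    simp [poleWeight, poleDamping_of_one_le α (hx _)]
  have hE : multipolarField s α ε b x = s • ∑ i, (sqDist ε (b i) x)⁻¹ • (x - b i) := by
    simp only [multipolarField, hw, poleProfile_of_one_le s (hx _), Finset.smul_sum,
      smul_smul, one_mul]
  have hdiv : s * (N - 2) * V ≤ divergence (multipolarField s α ε b) x := by
    rw [divergence_multipolarField s α hε, hV, Finset.mul_sum]
    refine Finset.sum_le_sum fun i _ => ?_
    simp only [hw, poleProfile_of_one_le s (hx _), deriv_poleProfile_of_one_le s (hx _),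
      deriv_poleDamping_of_one_le α (hx _), mul_zero, zero_mul, Finset.sum_const_zero, add_zero,
      one_mul]
    exact far_pole_divergence_le (sqDist_pos hε _ _) (sq_norm_le_sqDist _ _ _) hs0 N
  have hU := norm_sum_inv_smul_sq_le Finset.univ (fun i => x - b i) (fun i => sqDist ε (b i) x)
    (fun i _ => hx i) (fun i _ => sq_norm_le_sqDist _ _ _) (fun i _ j _ hij => by
      rw [sub_sub_sub_cancel_left]
      exact hb j i hij.symm)
  rw [Finset.card_univ, Fintype.card_fin, ← hV] at hU
  have hdiv' : 2 * s * V ≤ α⁻¹ * divergence (multipolarField s α ε b) x := by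
    rw [← div_eq_inv_mul, le_div_iff₀ hα0]
    calc _ = s * (N - 2) * V := by rw [hα]; ring
      _ ≤ _ := hdiv
  rw [hE, norm_smul, mul_pow, Real.norm_eq_abs, sq_abs]
  rcases hs with ⟨rfl, hn9⟩ | ⟨rfl, hn10⟩
  · have hn9' : (n : ℝ) ≤ 9 := by exact_mod_cast hn9
    linarith [few_poles_outer_bound hn2' hn9' hU]
  · nlinarith

theorem poleDamping_rpow_sub_one (α : ℝ) {q : ℝ} (hq : 0 < q) :
    (1 - truncSq q) ^ (α - 1) = poleDamping α q / (1 - truncSq q) := by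
  rw [poleDamping, Real.rpow_sub_one (sub_pos.2 (truncSq_lt_one hq)).ne']

/-- The profile decreases, so `r²` enters with a negative coefficient and may be replaced by `q`. -/
theorem near_pole_divergence_le {q r : ℝ} (hq : 0 < q) (hq1 : q < 1) (hr : r ^ 2 ≤ q)
    (hs0 : 0 ≤ s) (hs1 : s ≤ 1) (M : ℝ) :
    (M - 2) * ((s + (1 - s) * (1 - q) ^ 2) / q) - 4 * (1 - s) * (1 - q) ≤
      M * poleProfile s q + 2 * deriv (poleProfile s) q * r ^ 2 := by
  rw [(hasDerivAt_poleProfile s hq.ne').deriv, poleProfile, truncSq_of_le_one hq1.le,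
    max_eq_left (sub_nonneg.2 hq1.le)]
  set h := s + (1 - s) * (1 - q) ^ 2 with hh
  have hh0 : 0 ≤ h := add_nonneg hs0 (mul_nonneg (sub_nonneg.2 hs1) (sq_nonneg _))
  have h1 : 0 ≤ 2 * (1 - s) * (1 - q) / q + h / q ^ 2 := by
    have : 0 ≤ 1 - s := by linarith
    have : 0 ≤ 1 - q := by linarith
    positivity
  have h2 := mul_le_mul_of_nonneg_left hr h1
  have h3 : (2 * (1 - s) * (1 - q) / q + h / q ^ 2) * q = 2 * (1 - s) * (1 - q) + h / q := by
    field_simp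
  rw [h3] at h2
  have h4 : -(2 * (1 - s) * (1 - q)) / q = -(2 * (1 - s) * (1 - q) / q) := neg_div _ _
  rw [h4]
  have h5 : (M - 2) * (h / q) = M * (h / q) - 2 * (h / q) := by ring
  rw [h5]
  linarith

/-- Poles are at distance at least `2`, so only the truncation at `i₀` is active: the field is the
near field at full weight plus `s χ` times the sum of the far ones. All terms singular in `q`
cancel, in `e2` for the near field alone and in `e3` for its product with the far fields. The
bounded remainder is `hscalar`. -/
theorem multipolarField_estimate_near (hN : 3 ≤ N) (hn2 : 2 ≤ n) (hε : 0 < ε)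
    (hb : ∀ i j, i ≠ j → 2 ≤ ‖b i - b j‖) (hs : (s = 3 / 4 ∧ n ≤ 9) ∨ (s = 0 ∧ 10 ≤ n))
    (hα : α = ((N : ℝ) - 2) / 2) (x : EuclideanSpace ℝ (Fin N)) {i₀ : Fin n}
    (hx : sqDist ε (b i₀) x < 1) :
    ∑ i, (sqDist ε (b i) x)⁻¹ - (n + 1) ≤
      α⁻¹ * divergence (multipolarField s α ε b) x - ‖multipolarField s α ε b x‖ ^ 2 := by
  have hN' : (3 : ℝ) ≤ N := by exact_mod_cast hN
  have hn2' : (2 : ℝ) ≤ n := by exact_mod_cast hn2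
  have hα0 : 0 < α := by rw [hα]; linarith
  have hs0 : 0 ≤ s := by rcases hs with h | h <;> rw [h.1]; norm_num
  have hs1 : s ≤ 1 := by rcases hs with h | h <;> rw [h.1] <;> norm_num
  set q := sqDist ε (b i₀) x with hqdef
  have hq0 : 0 < q := sqDist_pos hε _ _
  set r := ‖x - b i₀‖ with hr
  have hr0 : 0 ≤ r := norm_nonneg _
  have hrq : r ^ 2 ≤ q := sq_norm_le_sqDist _ _ _
  have hr1 : r < 1 := by nlinarith
  set S := Finset.univ.erase i₀ with hS
  have hSc : (S.card : ℝ) = n - 1 := by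
    rw [hS, Finset.card_erase_of_mem (Finset.mem_univ _), Finset.card_univ, Fintype.card_fin,
      Nat.cast_sub (by omega)]
    simp
  have hfar : ∀ j ∈ S, 2 - r ≤ ‖x - b j‖ := by
    intro j hj
    have h1 := hb i₀ j (Finset.ne_of_mem_erase hj).symm
    have h2 := norm_sub_le (x - b j) (x - b i₀)
    rw [sub_sub_sub_cancel_left] at h2
    linarith
  have hqj' : ∀ j ∈ S, (2 - r) ^ 2 ≤ sqDist ε (b j) x := fun j hj =>
    (pow_le_pow_left₀ (by linarith) (hfar j hj) 2).trans (sq_norm_le_sqDist _ _ _)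
  have hqj : ∀ j ∈ S, 1 ≤ sqDist ε (b j) x := fun j hj =>
    le_trans (by nlinarith) (hqj' j hj)
  set χ := poleDamping α q with hχ
  have hχ0 : 0 ≤ χ := poleDamping_nonneg α hq0
  have hχ1 : χ ≤ 1 := poleDamping_le_one hα0.le hq0
  set B := ∑ j ∈ S, (sqDist ε (b j) x)⁻¹ with hB
  set v := ∑ j ∈ S, (sqDist ε (b j) x)⁻¹ • (x - b j) with hv
  set y := inner ℝ (x - b i₀) v with hy
  have hB0 : 0 ≤ B := Finset.sum_nonneg fun j _ => inv_nonneg.2 (sqDist_pos hε (b j) x).le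
  have hBn : B ≤ n - 1 := by
    rw [← hSc]
    refine (Finset.sum_le_card_nsmul _ _ 1 fun j hj => inv_le_one_of_one_le₀ (hqj j hj)).trans ?_
    simp
  have hw0 : poleWeight α ε b i₀ x = 1 := by
    rw [poleWeight, Finset.sum_eq_zero fun j hj => by rw [poleDamping_of_one_le α (hqj j hj), sub_self],
      sub_zero]
  have hmem : ∀ j ∈ S, i₀ ∈ Finset.univ.erase j := fun j hj =>
    Finset.mem_erase.2 ⟨(Finset.ne_of_mem_erase hj).symm, Finset.mem_univ _⟩
  have hwj : ∀ j ∈ S, poleWeight α ε b j x = χ := by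
    intro j hj
    rw [poleWeight, Finset.sum_eq_single_of_mem i₀ (hmem j hj) fun k _ hk => by
      rw [poleDamping_of_one_le α (hqj k (Finset.mem_erase.2 ⟨hk, Finset.mem_univ _⟩)), sub_self]]
    ring
  have hE : multipolarField s α ε b x = poleProfile s q • (x - b i₀) + (s * χ) • v := by
    rw [multipolarField, ← Finset.add_sum_erase _ _ (Finset.mem_univ i₀), hw0, one_smul, hv,
      Finset.smul_sum]
    congr 1
    refine Finset.sum_congr rfl fun j hj => ?_
    rw [hwj j hj, poleProfile_of_one_le s (hqj j hj), smul_smul, smul_smul]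
    congr 1
    ring
  set P := poleProfile s q with hP
  have hnorm : ‖multipolarField s α ε b x‖ ^ 2 =
      P ^ 2 * r ^ 2 + 2 * P * (s * χ) * y + s ^ 2 * χ ^ 2 * ‖v‖ ^ 2 := by
    rw [hE, norm_add_sq_real, norm_smul, norm_smul, mul_pow, mul_pow, Real.norm_eq_abs, sq_abs,
      Real.norm_eq_abs, sq_abs, real_inner_smul_left, real_inner_smul_right, ← hy]
    ring
  -- The exponent `α` in the damping produces the factor `α`, which `α⁻¹` removes; the rest is `χ
  -- (1/q - 1/(2 - q))`, whose singular part matches that of the profile.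
  have hdχ : deriv (poleDamping α) q = α * (2 * (1 - q) * (χ / (q * (2 - q)))) := by
    rw [(hasDerivAt_poleDamping α hq0).deriv, poleDamping_rpow_sub_one α hq0,
      truncSq_of_le_one hx.le, max_eq_left (sub_nonneg.2 hx.le), ← hχ]
    have : 1 - (1 - q) ^ 2 = q * (2 - q) := by ring
    rw [this]
    ring
  have hdiv : ((N : ℝ) - 2) * ((s + (1 - s) * (1 - q) ^ 2) / q) - 4 * (1 - s) * (1 - q) +
      (χ * (s * (N - 2) * B) + 2 * s * deriv (poleDamping α) q * y) ≤
      divergence (multipolarField s α ε b) x := by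
    rw [divergence_multipolarField s α hε, ← Finset.add_sum_erase _ _ (Finset.mem_univ i₀)]
    refine add_le_add ?_ ?_
    · rw [hw0, one_mul, Finset.sum_eq_zero fun j hj => by
        rw [deriv_poleDamping_of_one_le α (hqj j hj)]; ring, mul_zero, add_zero]
      exact near_pole_divergence_le hq0 hx hrq hs0 hs1 N
    · rw [hB, hy, hv, inner_sum, Finset.mul_sum, Finset.mul_sum, Finset.mul_sum,
        ← Finset.sum_add_distrib]
      refine Finset.sum_le_sum fun j hj => ?_
      rw [hwj j hj, Finset.sum_eq_single_of_mem i₀ (hmem j hj) fun k _ hk => by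
        rw [deriv_poleDamping_of_one_le α (hqj k (Finset.mem_erase.2 ⟨hk, Finset.mem_univ _⟩))]
        ring, poleProfile_of_one_le s (hqj j hj), deriv_poleProfile_of_one_le s (hqj j hj),
        real_inner_smul_right]
      refine add_le_add (mul_le_mul_of_nonneg_left ?_ hχ0) (le_of_eq (by ring))
      exact far_pole_divergence_le (sqDist_pos hε _ _) (sq_norm_le_sqDist _ _ _) hs0 N
  have hVB : ∑ i, (sqDist ε (b i) x)⁻¹ = q⁻¹ + B := by
    rw [← Finset.add_sum_erase _ _ (Finset.mem_univ i₀)]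
  -- The regular remainder of the cross term: the profile is `1/q - (1 - s)(2 - q)`, and subtracting
  -- `1/q - 1/(2 - q)` from it leaves `m`.
  set m := 1 / (2 - q) - (1 - s) * (2 - q) with hm
  have hβ : α⁻¹ ≤ 2 := by
    rw [inv_le_comm₀ hα0 two_pos, hα]
    linarith
  have h2q : 0 < 2 - q := by linarith
  have hscalar : (1 - s) ^ 2 * (q * (2 - q) ^ 2) + 4 * α⁻¹ * (1 - s) * (1 - q) + B -
      2 * s * χ * B + 2 * s * χ * m * y + s ^ 2 * χ ^ 2 * ‖v‖ ^ 2 ≤ n + 1 := by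
    rcases hs with ⟨rfl, hn9⟩ | ⟨rfl, hn10⟩
    · have hn9' : (n : ℝ) ≤ 9 := by exact_mod_cast hn9
      refine few_poles_inner_bound hn2' hn9' hq0 hx.le hB0 hBn hχ0 hχ1 ?_ ?_ hβ ?_
        (sq_nonneg _) ?_
      · rw [hm, sub_nonneg, le_div_iff₀ h2q]
        nlinarith
      · rw [hm, sub_le_iff_le_add, div_le_iff₀ h2q]
        nlinarith
      · rw [← hSc]
        refine two_mul_inner_sum_le S (fun j => x - b j) (fun j => sqDist ε (b j) x) (x - b i₀) q
          hqj (fun j _ => sq_norm_le_sqDist _ _ _) hrq fun j hj => ?_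
        rw [sub_sub_sub_cancel_left]
        exact hb j i₀ (Finset.ne_of_mem_erase hj)
      · have hU := norm_sum_inv_smul_sq_le S (fun j => x - b j) (fun j => sqDist ε (b j) x)
          hqj (fun j _ => sq_norm_le_sqDist _ _ _) (fun i _ j _ hij => by
            rw [sub_sub_sub_cancel_left]
            exact hb j i hij.symm)
        rw [hSc] at hU
        refine hU.trans (le_of_eq ?_)
        ring
    · have hn10' : (10 : ℝ) ≤ n := by exact_mod_cast hn10
      have hsq1 : √q ≤ 1 := Real.sqrt_le_one.2 hx.le
      have hrs : r ≤ √q := Real.le_sqrt_of_sq_le hrq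
      have hBs : B * (2 - √q) ^ 2 ≤ n - 1 := by
        rw [hB, Finset.sum_mul, ← hSc]
        refine (Finset.sum_le_card_nsmul _ _ 1 fun j hj => ?_).trans (by simp)
        rw [inv_mul_le_iff₀ (sqDist_pos hε _ _), mul_one]
        exact (pow_le_pow_left₀ (by linarith) (by linarith) 2).trans (hqj' j hj)
      have := many_poles_inner_bound hn10' (Real.sqrt_nonneg q) hsq1 (Real.sq_sqrt hq0.le).symm
        hβ hBs
      linarith
  have hdiv' := mul_le_mul_of_nonneg_left hdiv (inv_nonneg.2 hα0.le)
  have hαN : α⁻¹ * ((N : ℝ) - 2) = 2 := by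
    rw [inv_mul_eq_iff_eq_mul₀ hα0.ne', hα]
    ring
  have hPq : P = (s + (1 - s) * (1 - q) ^ 2) / q := by
    rw [hP, poleProfile, truncSq_of_le_one hx.le]
  have hPr : P ^ 2 * r ^ 2 ≤ (s + (1 - s) * (1 - q) ^ 2) ^ 2 / q := by
    calc P ^ 2 * r ^ 2 ≤ P ^ 2 * q := mul_le_mul_of_nonneg_left hrq (sq_nonneg _)
      _ = _ := by rw [hPq]; field_simp
  have e1 : α⁻¹ * (((N : ℝ) - 2) * ((s + (1 - s) * (1 - q) ^ 2) / q) - 4 * (1 - s) * (1 - q) +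
      (χ * (s * (N - 2) * B) + 2 * s * deriv (poleDamping α) q * y)) =
      2 * ((s + (1 - s) * (1 - q) ^ 2) / q) - 4 * α⁻¹ * (1 - s) * (1 - q) + 2 * s * χ * B +
        4 * s * (1 - q) * (χ / (q * (2 - q))) * y := by
    calc _ = (α⁻¹ * ((N : ℝ) - 2)) * ((s + (1 - s) * (1 - q) ^ 2) / q) -
          4 * α⁻¹ * (1 - s) * (1 - q) + (α⁻¹ * ((N : ℝ) - 2)) * s * χ * B +
          2 * s * (α⁻¹ * deriv (poleDamping α) q) * y := by ring
      _ = _ := by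
        rw [hαN, hdχ, inv_mul_cancel_left₀ hα0.ne']
        ring
  -- With `h = s + (1 - s)(1 - q)²` the left side is `-(1 - h)²/q`, and `1 - h = (1 - s) q (2 - q)`
  -- cancels the pole.
  have e2 : 2 * ((s + (1 - s) * (1 - q) ^ 2) / q) - (s + (1 - s) * (1 - q) ^ 2) ^ 2 / q - q⁻¹ =
      -((1 - s) ^ 2 * (q * (2 - q) ^ 2)) := by
    field_simp
    ring
  have e3 : 4 * s * (1 - q) * (χ / (q * (2 - q))) * y - 2 * P * (s * χ) * y =
      -(2 * s * χ * m * y) := by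
    rw [hPq, hm]
    field_simp
    ring
  rw [e1] at hdiv'
  rw [hVB, hnorm]
  linarith

/-- The vector field behind the multipolar Hardy inequality, for poles at mutual distance at least
`2`. -/
theorem multipolarField_estimate (hN : 3 ≤ N) (hn2 : 2 ≤ n) (hε : 0 < ε)
    (hb : ∀ i j, i ≠ j → 2 ≤ ‖b i - b j‖) (hs : (s = 3 / 4 ∧ n ≤ 9) ∨ (s = 0 ∧ 10 ≤ n))
    (hα : α = ((N : ℝ) - 2) / 2) (x : EuclideanSpace ℝ (Fin N)) :
    ∑ i, (sqDist ε (b i) x)⁻¹ - (n + 1) ≤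
      α⁻¹ * divergence (multipolarField s α ε b) x - ‖multipolarField s α ε b x‖ ^ 2 := by
  by_cases h : ∀ i, 1 ≤ sqDist ε (b i) x
  · exact multipolarField_estimate_far hN hn2 hε hb hs hα x h
  · push Not at h
    obtain ⟨i₀, hi₀⟩ := h
    exact multipolarField_estimate_near hN hn2 hε hb hs hα x hi₀

end MultipolarField

/-! ### The Gaussian density, its drift and its normalization. -/

section GaussianDensity

open Filter Metric
open scoped Topology

variable {N n : ℕ} {A : Matrix (Fin N) (Fin N) ℝ} {a : Fin n → EuclideanSpace ℝ (Fin N)}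

theorem gaussianWeight_pos (A : Matrix (Fin N) (Fin N) ℝ) (a : Fin n → EuclideanSpace ℝ (Fin N))
    (x : EuclideanSpace ℝ (Fin N)) : 0 < gaussianWeight A a x := Real.exp_pos _

theorem contDiff_toEuclideanLin (A : Matrix (Fin N) (Fin N) ℝ) :
    ContDiff ℝ ∞ fun x => Matrix.toEuclideanLin A x :=
  (LinearMap.toContinuousLinearMap (Matrix.toEuclideanLin A)).contDiff

theorem contDiff_gaussianWeight (A : Matrix (Fin N) (Fin N) ℝ)
    (a : Fin n → EuclideanSpace ℝ (Fin N)) : ContDiff ℝ ∞ (gaussianWeight A a) := by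
  refine Real.contDiff_exp.comp (contDiff_const.mul (ContDiff.sum fun i _ => ?_))
  have h : ContDiff ℝ ∞ fun x : EuclideanSpace ℝ (Fin N) => x - a i := by fun_prop
  exact ((contDiff_toEuclideanLin A).comp h).inner ℝ h

/-- The gradient of the quadratic form `½ ∑ᵢ ⟨A (x - aᵢ), x - aᵢ⟩` in the exponent of the Gaussian
weight. -/
noncomputable def gaussianDrift (A : Matrix (Fin N) (Fin N) ℝ)
    (a : Fin n → EuclideanSpace ℝ (Fin N)) (x : EuclideanSpace ℝ (Fin N)) :
    EuclideanSpace ℝ (Fin N) :=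
  ∑ i, Matrix.toEuclideanLin A (x - a i)

theorem contDiff_gaussianDrift (A : Matrix (Fin N) (Fin N) ℝ)
    (a : Fin n → EuclideanSpace ℝ (Fin N)) : ContDiff ℝ 1 (gaussianDrift A a) := by
  refine ContDiff.sum fun i _ => ?_
  have h : ContDiff ℝ 1 fun x : EuclideanSpace ℝ (Fin N) => x - a i := by fun_prop
  exact ((contDiff_toEuclideanLin A).of_le (by simp)).comp h

theorem hasFDerivAt_toEuclideanLin_sub (A : Matrix (Fin N) (Fin N) ℝ)
    (c x : EuclideanSpace ℝ (Fin N)) :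
    HasFDerivAt (fun x => Matrix.toEuclideanLin A (x - c))
      (LinearMap.toContinuousLinearMap (Matrix.toEuclideanLin A)) x :=
  (LinearMap.toContinuousLinearMap (Matrix.toEuclideanLin A)).hasFDerivAt.comp x
    ((hasFDerivAt_id x).sub_const c)

theorem divergence_gaussianDrift (A : Matrix (Fin N) (Fin N) ℝ)
    (a : Fin n → EuclideanSpace ℝ (Fin N)) (x : EuclideanSpace ℝ (Fin N)) :
    divergence (gaussianDrift A a) x = n * A.trace := by
  unfold gaussianDrift
  rw [divergence_sum _ fun i _ => (hasFDerivAt_toEuclideanLin_sub A (a i) x).differentiableAt]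
  have h : ∀ i, divergence (fun x => Matrix.toEuclideanLin A (x - a i)) x = A.trace := by
    intro i
    rw [divergence, (hasFDerivAt_toEuclideanLin_sub A (a i) x).fderiv, Matrix.trace]
    refine Finset.sum_congr rfl fun k _ => ?_
    simp [Matrix.toLpLin_apply]
  rw [Finset.sum_congr rfl fun i _ => h i]
  simp

/-- Symmetry of `A` makes the two halves of the derivative of the quadratic form equal, which
cancels the factor `1/2`. -/
theorem fderiv_gaussianWeight (hA : A.IsHermitian) (a : Fin n → EuclideanSpace ℝ (Fin N))
    (x v : EuclideanSpace ℝ (Fin N)) :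
    fderiv ℝ (gaussianWeight A a) x v =
      -(gaussianWeight A a x * inner ℝ (gaussianDrift A a x) v) := by
  have hsym : ∀ y z : EuclideanSpace ℝ (Fin N),
      inner ℝ (Matrix.toEuclideanLin A y) z = inner ℝ y (Matrix.toEuclideanLin A z) :=
    Matrix.isSymmetric_toEuclideanLin_iff.2 hA
  have h1 := (HasFDerivAt.fun_sum (u := Finset.univ) fun i _ =>
    (hasFDerivAt_toEuclideanLin_sub A (a i) x).inner ℝ ((hasFDerivAt_id x).sub_const (a i)))
  have h2 : HasFDerivAt (gaussianWeight A a) _ x := (h1.const_mul (-(1 / 2 : ℝ))).exp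
  rw [h2.fderiv]
  simp only [smul_apply, smul_eq_mul, sum_apply, ContinuousLinearMap.comp_apply,
    ContinuousLinearMap.prod_apply, fderivInnerCLM_apply, ContinuousLinearMap.id_apply, id,
    LinearMap.coe_toContinuousLinearMap', gaussianDrift, sum_inner]
  rw [gaussianWeight, ← mul_neg]
  congr 1
  rw [Finset.mul_sum, ← Finset.sum_neg_distrib]
  refine Finset.sum_congr rfl fun i _ => ?_
  rw [hsym v, real_inner_comm _ v]
  ring

/-- The form attains a positive minimum on the compact unit sphere; homogeneity does the rest. An
empty sphere is the zero-dimensional case. -/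
theorem Matrix.PosDef.exists_mul_norm_sq_le {A : Matrix (Fin N) (Fin N) ℝ} (hA : A.PosDef) :
    ∃ b : ℝ, 0 < b ∧ ∀ y : EuclideanSpace ℝ (Fin N),
      b * ‖y‖ ^ 2 ≤ inner ℝ (Matrix.toEuclideanLin A y) y := by
  have hpos : ∀ y : EuclideanSpace ℝ (Fin N), y ≠ 0 → 0 < inner ℝ (Matrix.toEuclideanLin A y) y := by
    intro y hy
    have h := hA.dotProduct_mulVec_pos (x := y.ofLp) (by simpa using hy)
    rw [real_inner_comm, EuclideanSpace.inner_eq_star_dotProduct, dotProduct_comm]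
    simpa using h
  have hcont : Continuous fun y : EuclideanSpace ℝ (Fin N) =>
      inner ℝ (Matrix.toEuclideanLin A y) y :=
    (contDiff_toEuclideanLin A).continuous.inner continuous_id
  rcases (sphere (0 : EuclideanSpace ℝ (Fin N)) 1).eq_empty_or_nonempty with he | hne
  · refine ⟨1, one_pos, fun y => ?_⟩
    have hy : y = 0 := by
      by_contra hy
      have : (‖y‖⁻¹ • y) ∈ sphere (0 : EuclideanSpace ℝ (Fin N)) 1 := by
        rw [mem_sphere_zero_iff_norm, norm_smul, norm_inv, norm_norm,
          inv_mul_cancel₀ (norm_ne_zero_iff.2 hy)]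
      simp [he] at this
    simp [hy]
  · obtain ⟨z, hz, hmin⟩ := (isCompact_sphere (0 : EuclideanSpace ℝ (Fin N)) 1).exists_isMinOn hne
      hcont.continuousOn
    refine ⟨_, hpos z (ne_zero_of_mem_unit_sphere ⟨z, hz⟩), fun y => ?_⟩
    rcases eq_or_ne y 0 with rfl | hy
    · simp
    have hy0 : 0 < ‖y‖ := norm_pos_iff.2 hy
    have hmem : (‖y‖⁻¹ • y) ∈ sphere (0 : EuclideanSpace ℝ (Fin N)) 1 := by
      rw [mem_sphere_zero_iff_norm, norm_smul, norm_inv, norm_norm, inv_mul_cancel₀ hy0.ne']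
    have h := hmin hmem
    simp only [Set.mem_ofPred_eq, map_smul, inner_smul_left, inner_smul_right, conj_trivial] at h
    calc _ ≤ ‖y‖⁻¹ * (‖y‖⁻¹ * inner ℝ (Matrix.toEuclideanLin A y) y) * ‖y‖ ^ 2 :=
          mul_le_mul_of_nonneg_right h (sq_nonneg _)
      _ = _ := by field_simp

/-- Integrability is the point: for a non-integrable weight the integral, and so its inverse, would
be `0`. One summand of the exponent already gives a dominating Gaussian. -/
theorem gaussianConst_pos (hn : n ≠ 0) {A : Matrix (Fin N) (Fin N) ℝ} (hA : A.PosDef)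
    (a : Fin n → EuclideanSpace ℝ (Fin N)) : 0 < gaussianConst A a := by
  obtain ⟨b, hb, hbA⟩ := hA.exists_mul_norm_sq_le
  let i₀ : Fin n := ⟨0, Nat.pos_of_ne_zero hn⟩
  have hg : Integrable fun x : EuclideanSpace ℝ (Fin N) => Real.exp (-(b / 2) * ‖x‖ ^ 2) := by
    have h := (GaussianFourier.integrable_cexp_neg_mul_sq_norm_add (b := ((b / 2 : ℝ) : ℂ))
      (by rw [Complex.ofReal_re]; positivity) 0 (0 : EuclideanSpace ℝ (Fin N))).norm
    refine h.congr (Eventually.of_forall fun x => ?_)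
    simp only [zero_mul, add_zero, Complex.norm_exp]
    norm_cast
  have hi : Integrable (gaussianWeight A a) := by
    refine (hg.comp_sub_right (a i₀)).mono'
      (contDiff_gaussianWeight A a).continuous.aestronglyMeasurable
      (Eventually.of_forall fun x => ?_)
    rw [Real.norm_of_nonneg (gaussianWeight_pos A a x).le, gaussianWeight]
    refine Real.exp_le_exp.2 ?_
    have h1 : b * ‖x - a i₀‖ ^ 2 ≤
        ∑ i, inner ℝ (Matrix.toEuclideanLin A (x - a i)) (x - a i) :=
      (hbA _).trans (Finset.single_le_sum
        (f := fun i => inner ℝ (Matrix.toEuclideanLin A (x - a i)) (x - a i))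
        (fun i _ => le_trans (by positivity) (hbA (x - a i))) (Finset.mem_univ i₀))
    linarith
  exact inv_pos.2 (integral_exp_pos hi)

theorem poleRadius_spec (hn : 2 ≤ n) (ha : Function.Injective a) :
    0 < poleRadius a ∧ ∀ i j, i ≠ j → 2 * poleRadius a ≤ ‖a i - a j‖ := by
  have : Nonempty {p : Fin n × Fin n // p.1 ≠ p.2} :=
    ⟨⟨(⟨0, by omega⟩, ⟨1, by omega⟩), by simp⟩⟩
  have hle : ∀ i j, i ≠ j → 2 * poleRadius a ≤ ‖a i - a j‖ := by
    intro i j hij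
    rw [poleRadius, mul_div_cancel₀ _ two_ne_zero]
    exact ciInf_le (f := fun p : {p : Fin n × Fin n // p.1 ≠ p.2} => ‖a p.1.1 - a p.1.2‖)
      (Set.finite_range _).bddBelow ⟨(i, j), hij⟩
  refine ⟨?_, hle⟩
  obtain ⟨p, hp⟩ := exists_eq_ciInf_of_finite
    (f := fun p : {p : Fin n × Fin n // p.1 ≠ p.2} => ‖a p.1.1 - a p.1.2‖)
  rw [poleRadius, ← hp]
  exact half_pos (norm_pos_iff.2 (sub_ne_zero.2 fun h => p.2 (ha h)))

end GaussianDensity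

/-! ### The Hardy inequality at the critical constant. -/

section MultipolarHardy

open Filter
open scoped Topology

variable {N n : ℕ} {A : Matrix (Fin N) (Fin N) ℝ} {a : Fin n → EuclideanSpace ℝ (Fin N)}
  {φ : EuclideanSpace ℝ (Fin N) → ℝ} {G : EuclideanSpace ℝ (Fin N) → EuclideanSpace ℝ (Fin N)}

theorem sum_inv_sqDist_smul {r ε : ℝ} (hr : r ≠ 0) (x : EuclideanSpace ℝ (Fin N)) :
    ∑ i, (sqDist ε (r⁻¹ • a i) (r⁻¹ • x))⁻¹ = r ^ 2 * ∑ i, (sqDist (r * ε) (a i) x)⁻¹ := by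
  rw [Finset.mul_sum]
  refine Finset.sum_congr rfl fun i _ => ?_
  have h : sqDist ε (r⁻¹ • a i) (r⁻¹ • x) = (r ^ 2)⁻¹ * sqDist (r * ε) (a i) x := by
    rw [sqDist, sqDist, ← smul_sub, norm_smul, mul_pow, norm_inv, Real.norm_eq_abs, inv_pow, sq_abs,
      mul_pow]
    field_simp
  rw [h, mul_inv, inv_inv]

/-- Dividing by `r = poleRadius a` puts the poles at distance at least `2`. The field `F x = (α / r)
E (x / r)` turns the pointwise estimate, multiplied by `α² / r²`, into a bound for `div F - |F|²`.
-/
theorem regularized_hardy (hN : 3 ≤ N) (hn : 2 ≤ n) (hA : A.PosDef) (ha : Function.Injective a)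
    (hC : 0 < gaussianConst A a) (hφ : MemH1 (gaussianMeasure A a) φ G) {ε : ℝ} (hε : 0 < ε) :
    hardyConst N * ∫ x, (∑ i, (sqDist (poleRadius a * ε) (a i) x)⁻¹) * φ x ^ 2
        ∂(gaussianMeasure A a) ≤
      ∫ x, ‖G x‖ ^ 2 ∂(gaussianMeasure A a) +
        (((n : ℝ) + 1) * hardyConst N / poleRadius a ^ 2 + (n : ℝ) / 2 * A.trace) *
          ∫ x, φ x ^ 2 ∂(gaussianMeasure A a) := by
  obtain ⟨hr, hdist⟩ := poleRadius_spec hn ha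
  set r := poleRadius a with hrdef
  set α : ℝ := ((N : ℝ) - 2) / 2 with hα
  have hN' : (3 : ℝ) ≤ N := by exact_mod_cast hN
  have hα0 : 0 < α := by rw [hα]; linarith
  have hco : hardyConst N = α ^ 2 := rfl
  obtain ⟨s, hs⟩ : ∃ s : ℝ, (s = 3 / 4 ∧ n ≤ 9) ∨ (s = 0 ∧ 10 ≤ n) := by
    rcases Nat.lt_or_ge 9 n with h | h
    · exact ⟨0, Or.inr ⟨rfl, h⟩⟩
    · exact ⟨3 / 4, Or.inl ⟨rfl, h⟩⟩
  have hs0 : 0 ≤ s := by rcases hs with h | h <;> rw [h.1]; norm_num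
  have hs1 : s ≤ 1 := by rcases hs with h | h <;> rw [h.1] <;> norm_num
  set b : Fin n → EuclideanSpace ℝ (Fin N) := fun i => r⁻¹ • a i with hb
  have hbd : ∀ i j, i ≠ j → 2 ≤ ‖b i - b j‖ := by
    intro i j hij
    rw [hb, ← smul_sub, norm_smul, norm_inv, Real.norm_of_nonneg hr.le, ← div_eq_inv_mul,
      le_div_iff₀ hr]
    exact hdist i j hij
  set E := multipolarField s α ε b with hE
  have hEc : ContDiff ℝ 1 E := contDiff_multipolarField s α hε b
  have hEr : ContDiff ℝ 1 fun x => E (r⁻¹ • x) := hEc.comp (contDiff_const_smul _)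
  set F : EuclideanSpace ℝ (Fin N) → EuclideanSpace ℝ (Fin N) := fun x => (α * r⁻¹) • E (r⁻¹ • x)
    with hF
  have hFc : ContDiff ℝ 1 F := hEr.const_smul _
  set Q : EuclideanSpace ℝ (Fin N) → ℝ := fun x => ∑ i, (sqDist (r * ε) (a i) x)⁻¹ with hQ
  have hrε : 0 < r * ε := mul_pos hr hε
  have hQc : Continuous Q := continuous_finsetSum _ fun i _ =>
    (contDiff_sqDist (r * ε) (a i)).continuous.inv₀ fun x => (sqDist_pos hrε _ _).ne'
  have hQ0 : ∀ x, 0 ≤ Q x := fun x =>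
    Finset.sum_nonneg fun i _ => inv_nonneg.2 (sqDist_pos hrε (a i) x).le
  have hQB : ∀ x, Q x ≤ n * ((r * ε) ^ 2)⁻¹ := by
    intro x
    refine (Finset.sum_le_card_nsmul _ _ ((r * ε) ^ 2)⁻¹ fun i _ => ?_).trans (by simp)
    exact inv_anti₀ (by positivity) (le_add_of_nonneg_left (sq_nonneg _))
  set Z : EuclideanSpace ℝ (Fin N) → ℝ := fun x => α ^ 2 * Q x - (n + 1) * α ^ 2 / r ^ 2 with hZ
  have hZc : Continuous Z := (continuous_const.mul hQc).sub continuous_const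
  have hZB : ∀ x, |Z x| ≤ α ^ 2 * (n * ((r * ε) ^ 2)⁻¹) + (n + 1) * α ^ 2 / r ^ 2 := by
    intro x
    have h1 : 0 ≤ α ^ 2 * Q x := mul_nonneg (sq_nonneg _) (hQ0 x)
    have h2 : α ^ 2 * Q x ≤ α ^ 2 * (n * ((r * ε) ^ 2)⁻¹) :=
      mul_le_mul_of_nonneg_left (hQB x) (sq_nonneg _)
    have h3 : 0 ≤ (n + 1) * α ^ 2 / r ^ 2 := by positivity
    rw [abs_le]
    constructor <;> simp only [hZ] <;> linarith
  have hFZ : ∀ x, Z x ≤ divergence F x - ‖F x‖ ^ 2 := by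
    intro x
    have hest := multipolarField_estimate hN hn hε hbd hs hα (r⁻¹ • x)
    rw [hb, sum_inv_sqDist_smul hr.ne', ← hb, ← hE] at hest
    have hdiv : divergence F x = α * r⁻¹ * (r⁻¹ * divergence E (r⁻¹ • x)) := by
      rw [hF, divergence_const_smul _ (hEr.differentiable one_ne_zero x),
        divergence_comp_smul _ _ (hEc.differentiable one_ne_zero _)]
    have hn2 : ‖F x‖ ^ 2 = α ^ 2 * (r⁻¹) ^ 2 * ‖E (r⁻¹ • x)‖ ^ 2 := by
      rw [hF, norm_smul, mul_pow, Real.norm_eq_abs, sq_abs, mul_pow]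
    have h1 := mul_le_mul_of_nonneg_left hest (show 0 ≤ α ^ 2 * (r⁻¹) ^ 2 by positivity)
    have e1 : α ^ 2 * r⁻¹ ^ 2 * (r ^ 2 * ∑ i, (sqDist (r * ε) (a i) x)⁻¹ - (n + 1)) = Z x := by
      simp only [hZ, hQ]
      field_simp
    have e2 : α ^ 2 * r⁻¹ ^ 2 * (α⁻¹ * divergence E (r⁻¹ • x) - ‖E (r⁻¹ • x)‖ ^ 2) =
        divergence F x - ‖F x‖ ^ 2 := by
      rw [hdiv, hn2]
      field_simp
    rwa [e1, e2] at h1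
  set ρ : EuclideanSpace ℝ (Fin N) → ℝ := fun x => gaussianConst A a * gaussianWeight A a x
    with hρdef
  have hw1 : ContDiff ℝ 1 (gaussianWeight A a) := (contDiff_gaussianWeight A a).of_le (by simp)
  have hρ : ContDiff ℝ 1 ρ := contDiff_const.mul hw1
  have hρ0 : ∀ x, 0 < ρ x := fun x => mul_pos hC (gaussianWeight_pos A a x)
  have hρb : ∀ x v, fderiv ℝ ρ x v = -(ρ x * inner ℝ (gaussianDrift A a x) v) := by
    intro x v
    rw [hρdef, fderiv_const_mul (hw1.differentiable one_ne_zero x), smul_apply, smul_eq_mul,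
      fderiv_gaussianWeight hA.isHermitian]
    ring
  have hM : ∀ x, ‖F x‖ ≤ α * r⁻¹ * (n * ((1 + n) * ε⁻¹)) := by
    intro x
    rw [hF, norm_smul, Real.norm_of_nonneg (by positivity)]
    exact mul_le_mul_of_nonneg_left (norm_multipolarField_le hs0 hs1 hα0.le hε b _) (by positivity)
  have hτ0 : 0 ≤ (n : ℝ) * A.trace := mul_nonneg (Nat.cast_nonneg n) hA.posSemidef.trace_nonneg
  have hmain := MemH1.integral_mul_sq_le hρ hρ0 (contDiff_gaussianDrift A a) hρb
    (divergence_gaussianDrift A a) hτ0 hφ hFc hM hZc hZB hFZ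
  change ∫ x, Z x * φ x ^ 2 ∂(gaussianMeasure A a) ≤ ∫ x, ‖G x‖ ^ 2 ∂(gaussianMeasure A a) +
    n * A.trace / 2 * ∫ x, φ x ^ 2 ∂(gaussianMeasure A a) at hmain
  have iφ : Integrable (fun x => φ x ^ 2) (gaussianMeasure A a) := hφ.memLp.integrable_sq
  have iQ : Integrable (fun x => Q x * φ x ^ 2) (gaussianMeasure A a) :=
    iφ.bdd_mul hQc.aestronglyMeasurable (Eventually.of_forall fun x => by
      rw [Real.norm_of_nonneg (hQ0 x)]
      exact hQB x)
  have hsplit : ∫ x, Z x * φ x ^ 2 ∂(gaussianMeasure A a) =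
      α ^ 2 * ∫ x, Q x * φ x ^ 2 ∂(gaussianMeasure A a) -
        (n + 1) * α ^ 2 / r ^ 2 * ∫ x, φ x ^ 2 ∂(gaussianMeasure A a) := by
    rw [← integral_const_mul, ← integral_const_mul, ← integral_sub (iQ.const_mul _)
      (iφ.const_mul _)]
    refine integral_congr_ae (Eventually.of_forall fun x => ?_)
    simp only [hZ]
    ring
  rw [hsplit] at hmain
  rw [hco]
  linarith

/-- The regularized bound does not depend on `ε`, so Fatou's lemma yields integrability of the
singular term together with the inequality. -/
theorem multipolar_hardy (hN : 3 ≤ N) (hn : 2 ≤ n) (hA : A.PosDef) (ha : Function.Injective a)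
    (hφ : MemH1 (gaussianMeasure A a) φ G) :
    Integrable (fun x => multipolarPotential a x * φ x ^ 2) (gaussianMeasure A a) ∧
      hardyConst N * ∫ x, multipolarPotential a x * φ x ^ 2 ∂(gaussianMeasure A a) ≤
        ∫ x, ‖G x‖ ^ 2 ∂(gaussianMeasure A a) +
          (((n : ℝ) + 1) * hardyConst N / poleRadius a ^ 2 + (n : ℝ) / 2 * A.trace) *
            ∫ x, φ x ^ 2 ∂(gaussianMeasure A a) := by
  have hC : 0 < gaussianConst A a := gaussianConst_pos (by omega) hA a
  set μ := gaussianMeasure A a with hμ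
  set K := ∫ x, ‖G x‖ ^ 2 ∂μ +
    (((n : ℝ) + 1) * hardyConst N / poleRadius a ^ 2 + (n : ℝ) / 2 * A.trace) * ∫ x, φ x ^ 2 ∂μ
    with hK
  obtain ⟨hr, -⟩ := poleRadius_spec hn ha
  set r := poleRadius a with hrdef
  have hN' : (3 : ℝ) ≤ N := by exact_mod_cast hN
  have hco : 0 < hardyConst N := by
    have : 0 < ((N : ℝ) - 2) / 2 := by linarith
    exact pow_pos this 2
  let ε : ℕ → ℝ := fun k => 1 / ((k : ℝ) + 1)
  have hε0 : ∀ k, 0 < ε k := fun k => by positivity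
  have hε : Tendsto ε atTop (𝓝 0) := tendsto_one_div_add_atTop_nhds_zero_nat
  let f : ℕ → EuclideanSpace ℝ (Fin N) → ℝ := fun k x =>
    (∑ i, (sqDist (r * ε k) (a i) x)⁻¹) * φ x ^ 2
  have hf0 : ∀ k x, 0 ≤ f k x := fun k x => mul_nonneg (Finset.sum_nonneg fun i _ =>
    inv_nonneg.2 (sqDist_pos (mul_pos hr (hε0 k)) (a i) x).le) (sq_nonneg _)
  have hfi : ∀ k, Integrable (f k) μ := by
    intro k
    have hrε : 0 < r * ε k := mul_pos hr (hε0 k)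
    refine hφ.memLp.integrable_sq.bdd_mul (c := n * ((r * ε k) ^ 2)⁻¹) ?_
      (Eventually.of_forall fun x => ?_)
    · exact (continuous_finsetSum _ fun i _ => (contDiff_sqDist (r * ε k) (a i)).continuous.inv₀
        fun x => (sqDist_pos hrε _ _).ne').aestronglyMeasurable
    · rw [Real.norm_of_nonneg (Finset.sum_nonneg fun i _ =>
        inv_nonneg.2 (sqDist_pos hrε (a i) x).le)]
      refine (Finset.sum_le_card_nsmul _ _ ((r * ε k) ^ 2)⁻¹ fun i _ => ?_).trans (by simp)
      exact inv_anti₀ (by positivity) (le_add_of_nonneg_left (sq_nonneg _))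
  have hfK : ∀ k, ∫ x, f k x ∂μ ≤ K / hardyConst N := by
    intro k
    rw [le_div_iff₀ hco, mul_comm]
    exact regularized_hardy hN hn hA ha hC hφ (hε0 k)
  have hV0 : ∀ x, 0 ≤ multipolarPotential a x * φ x ^ 2 := fun x =>
    mul_nonneg (Finset.sum_nonneg fun i _ => by positivity) (sq_nonneg _)
  have : Nonempty (Fin N) := ⟨⟨0, by omega⟩⟩
  -- At a pole the convention `1 / 0 = 0` can break the pointwise convergence, but the poles form a
  -- null set.
  have hpole : ∀ᵐ x ∂μ, ∀ i, x ≠ a i := by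
    have h : ∀ᵐ x : EuclideanSpace ℝ (Fin N), ∀ i, x ≠ a i :=
      ae_all_iff.2 fun i => by simp [ae_iff]
    exact (withDensity_absolutelyContinuous _ _).ae_le h
  have hlim : ∀ᵐ x ∂μ, Tendsto (fun k => f k x) atTop
      (𝓝 (multipolarPotential a x * φ x ^ 2)) := by
    filter_upwards [hpole] with x hx
    refine Tendsto.mul_const _ (tendsto_finsetSum _ fun i _ => ?_)
    have h0 : ‖x - a i‖ ^ 2 ≠ 0 := pow_ne_zero 2 (norm_ne_zero_iff.2 (sub_ne_zero.2 (hx i)))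
    have h1 : Tendsto (fun k => sqDist (r * ε k) (a i) x) atTop (𝓝 (‖x - a i‖ ^ 2)) := by
      have := ((hε.const_mul r).pow 2).const_add (‖x - a i‖ ^ 2)
      simpa [sqDist] using this
    rw [one_div]
    exact h1.inv₀ h0
  have hVm : AEStronglyMeasurable (fun x => multipolarPotential a x * φ x ^ 2) μ :=
    aestronglyMeasurable_of_tendsto_ae atTop (fun k => (hfi k).1) hlim
  have hlint : ∫⁻ x, ENNReal.ofReal (multipolarPotential a x * φ x ^ 2) ∂μ ≤
      ENNReal.ofReal (K / hardyConst N) := by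
    calc ∫⁻ x, ENNReal.ofReal (multipolarPotential a x * φ x ^ 2) ∂μ
        = ∫⁻ x, liminf (fun k => ENNReal.ofReal (f k x)) atTop ∂μ := by
          refine lintegral_congr_ae ?_
          filter_upwards [hlim] with x hx
          exact ((ENNReal.continuous_ofReal.tendsto _).comp hx).liminf_eq.symm
      _ ≤ liminf (fun k => ∫⁻ x, ENNReal.ofReal (f k x) ∂μ) atTop :=
          lintegral_liminf_le' fun k => (hfi k).1.aemeasurable.ennreal_ofReal
      _ ≤ ENNReal.ofReal (K / hardyConst N) := by
          refine liminf_le_of_le (by isBoundedDefault) fun c hc => ?_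
          obtain ⟨k, hk⟩ := hc.exists
          refine hk.trans ?_
          rw [← ofReal_integral_eq_lintegral_ofReal (hfi k) (Eventually.of_forall (hf0 k))]
          exact ENNReal.ofReal_le_ofReal (hfK k)
  have hK0 : 0 ≤ K / hardyConst N := (integral_nonneg (hf0 0)).trans (hfK 0)
  refine ⟨⟨hVm, ?_⟩, ?_⟩
  · rw [hasFiniteIntegral_iff_ofReal (Eventually.of_forall hV0)]
    exact hlint.trans_lt ENNReal.ofReal_lt_top
  · rw [integral_eq_lintegral_of_nonneg_ae (Eventually.of_forall hV0) hVm, mul_comm,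
      ← le_div_iff₀ hco]
    exact ENNReal.toReal_le_of_le_ofReal hK0 hlint

end MultipolarHardy

/-! ### The truncated critical power. -/

section CriticalProfile

open Filter Metric
open scoped Topology

/-- A smooth cutoff on the line, equal to `1` on `[-l ^ 2, l ^ 2]` and to `0` outside
`(-2 * l ^ 2, 2 * l ^ 2)`. -/
noncomputable def lineCutoff (l s : ℝ) : ℝ :=
  (⟨1, 2, one_pos, one_lt_two⟩ : ContDiffBump (0 : ℝ)) (s / l ^ 2)

theorem contDiff_lineCutoff (l : ℝ) : ContDiff ℝ ∞ (lineCutoff l) :=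
  (ContDiffBump.contDiff _).comp (contDiff_id.div_const _)

theorem lineCutoff_nonneg (l s : ℝ) : 0 ≤ lineCutoff l s := ContDiffBump.nonneg _

theorem lineCutoff_le_one (l s : ℝ) : lineCutoff l s ≤ 1 := ContDiffBump.le_one _

theorem lineCutoff_eq_one {l s : ℝ} (hl : 0 < l) (hs : |s| ≤ l ^ 2) : lineCutoff l s = 1 := by
  refine ContDiffBump.one_of_mem_closedBall _ ?_
  rw [mem_closedBall_zero_iff, norm_div, Real.norm_eq_abs, Real.norm_of_nonneg (by positivity)]
  exact div_le_one_of_le₀ hs (by positivity)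

theorem lineCutoff_eq_zero {l s : ℝ} (hl : 0 < l) (hs : 2 * l ^ 2 ≤ |s|) : lineCutoff l s = 0 := by
  refine ContDiffBump.zero_of_le_dist _ ?_
  rw [dist_zero_right, norm_div, Real.norm_eq_abs, Real.norm_of_nonneg (by positivity)]
  exact (le_div_iff₀ (by positivity)).2 hs

/-- The operator `s d/ds` is invariant under dilations, so one constant serves every scale `l`. -/
theorem exists_abs_mul_deriv_lineCutoff_le :
    ∃ C : ℝ, ∀ l s, 0 < l → |s * deriv (lineCutoff l) s| ≤
      C * Set.indicator (Set.Icc (l ^ 2) (2 * l ^ 2)) (fun _ => (1 : ℝ)) |s| := by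
  set B : ContDiffBump (0 : ℝ) := ⟨1, 2, one_pos, one_lt_two⟩ with hB
  have hBc : ContDiff ℝ 1 B := B.contDiff
  obtain ⟨C, hC⟩ := (hBc.continuous_deriv le_rfl).bounded_above_of_compact_support
    B.hasCompactSupport.deriv
  refine ⟨2 * C, fun l s hl => ?_⟩
  have hl2 : 0 < l ^ 2 := by positivity
  have hC0 : 0 ≤ C := (norm_nonneg _).trans (hC 0)
  rcases lt_or_ge |s| (l ^ 2) with h1 | h1
  · have : lineCutoff l =ᶠ[𝓝 s] fun _ => 1 := by
      filter_upwards [(continuous_abs.tendsto s).eventually_lt_const h1] with t ht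
      exact lineCutoff_eq_one hl ht.le
    rw [this.deriv_eq, deriv_const, mul_zero, abs_zero]
    exact mul_nonneg (by positivity) (Set.indicator_nonneg (fun _ _ => zero_le_one) _)
  rcases lt_or_ge (2 * l ^ 2) |s| with h2 | h2
  · have : lineCutoff l =ᶠ[𝓝 s] fun _ => 0 := by
      filter_upwards [(continuous_abs.tendsto s).eventually_const_lt h2] with t ht
      exact lineCutoff_eq_zero hl ht.le
    rw [this.deriv_eq, deriv_const, mul_zero, abs_zero]
    exact mul_nonneg (by positivity) (Set.indicator_nonneg (fun _ _ => zero_le_one) _)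
  rw [Set.indicator_of_mem (show |s| ∈ Set.Icc (l ^ 2) (2 * l ^ 2) from ⟨h1, h2⟩), mul_one]
  have hd : deriv (lineCutoff l) s = deriv B (s / l ^ 2) * (1 / l ^ 2) :=
    (((hBc.differentiable one_ne_zero (s / l ^ 2)).hasDerivAt).comp s
      ((hasDerivAt_id s).div_const (l ^ 2))).deriv
  rw [hd, abs_mul, abs_mul, abs_of_nonneg (show 0 ≤ 1 / l ^ 2 by positivity)]
  have h3 : |deriv B (s / l ^ 2)| ≤ C := hC _
  calc |s| * (|deriv B (s / l ^ 2)| * (1 / l ^ 2))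
      ≤ (2 * l ^ 2) * (C * (1 / l ^ 2)) := by gcongr
    _ = 2 * C := by field_simp

/-- The critical power `s ^ (-α / 2)` truncated smoothly to `κ² ≤ s ≤ 2 δ²`. -/
noncomputable def criticalProfile (α κ δ s : ℝ) : ℝ :=
  s ^ (-α / 2) * (lineCutoff δ s * (1 - lineCutoff κ s))

theorem criticalProfile_eq_zero_of_le {α κ δ s : ℝ} (hκ : 0 < κ) (hs : |s| ≤ κ ^ 2) :
    criticalProfile α κ δ s = 0 := by
  simp [criticalProfile, lineCutoff_eq_one hκ hs]

theorem criticalProfile_eq_zero_of_ge {α κ δ s : ℝ} (hδ : 0 < δ) (hs : 2 * δ ^ 2 ≤ |s|) :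
    criticalProfile α κ δ s = 0 := by
  simp [criticalProfile, lineCutoff_eq_zero hδ hs]

theorem contDiff_criticalProfile {α κ δ : ℝ} (hκ : 0 < κ) :
    ContDiff ℝ ∞ (criticalProfile α κ δ) := by
  refine contDiff_iff_contDiffAt.2 fun s => ?_
  rcases eq_or_ne s 0 with rfl | hs
  · have h : criticalProfile α κ δ =ᶠ[𝓝 0] fun _ => 0 := by
      have h0 : |(0 : ℝ)| < κ ^ 2 := by rw [abs_zero]; positivity
      filter_upwards [(continuous_abs.tendsto (0 : ℝ)).eventually_lt_const h0] with t ht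
      exact criticalProfile_eq_zero_of_le hκ ht.le
    exact contDiffAt_const.congr_of_eventuallyEq h
  · exact (Real.contDiffAt_rpow_const_of_ne hs).mul ((contDiff_lineCutoff δ).contDiffAt.mul
      (contDiffAt_const.sub (contDiff_lineCutoff κ).contDiffAt))

/-- This is what makes the exponent critical: the squared power divided by `r²` is `r^(-N)`, whose
integral diverges logarithmically at the pole. -/
theorem rpow_neg_half_sq {N : ℕ} {α r : ℝ} (hα : α = ((N : ℝ) - 2) / 2) (hr : 0 < r) :
    ((r ^ 2) ^ (-α / 2)) ^ 2 = r ^ 2 * (r ^ N)⁻¹ := by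
  rw [← Real.rpow_natCast ((r ^ 2) ^ (-α / 2)) 2, ← Real.rpow_mul (by positivity),
    ← Real.rpow_natCast r 2, ← Real.rpow_mul hr.le, ← Real.rpow_natCast r N, ← Real.rpow_neg hr.le,
    ← Real.rpow_add hr]
  congr 1
  rw [hα]
  push_cast
  ring

theorem sq_criticalProfile_div {N : ℕ} {α κ δ r : ℝ} (hα : α = ((N : ℝ) - 2) / 2) (hr : 0 < r) :
    criticalProfile α κ δ (r ^ 2) ^ 2 / r ^ 2 =
      (r ^ N)⁻¹ * (lineCutoff δ (r ^ 2) * (1 - lineCutoff κ (r ^ 2))) ^ 2 := by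
  rw [criticalProfile, mul_pow, rpow_neg_half_sq hα hr]
  field_simp

/-- Differentiating the power gives the main term, with constant `α²`. Differentiating a cutoff of
scale `l` gives an error of size `l^(-N)` on radii at most `2 l`. Young's inequality separates them,
and `M` is independent of `κ` and `δ`. -/
theorem exists_sq_deriv_criticalProfile_le {N : ℕ} {α τ : ℝ} (hα : α = ((N : ℝ) - 2) / 2)
    (hτ : 0 < τ) :
    ∃ M : ℝ, 0 ≤ M ∧ ∀ κ δ r : ℝ, 0 < κ → 0 < δ → 0 ≤ r →
      (2 * r * deriv (criticalProfile α κ δ) (r ^ 2)) ^ 2 ≤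
        (1 + τ) * α ^ 2 * (criticalProfile α κ δ (r ^ 2) ^ 2 / r ^ 2) +
          M * ((κ ^ N)⁻¹ * Set.indicator (Set.Iic (2 * κ)) 1 r +
            (δ ^ N)⁻¹ * Set.indicator (Set.Iic (2 * δ)) 1 r) := by
  obtain ⟨C, hC⟩ := exists_abs_mul_deriv_lineCutoff_le
  have hterm : ∀ l r : ℝ, 0 < l → 0 < r →
      (r ^ N)⁻¹ * (r ^ 2 * deriv (lineCutoff l) (r ^ 2)) ^ 2 ≤
        C ^ 2 * ((l ^ N)⁻¹ * Set.indicator (Set.Iic (2 * l)) 1 r) := by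
    intro l r hl hr
    have h := hC l (r ^ 2) hl
    have h2 : (r ^ 2 * deriv (lineCutoff l) (r ^ 2)) ^ 2 ≤
        (C * Set.indicator (Set.Icc (l ^ 2) (2 * l ^ 2)) (fun _ => (1 : ℝ)) |r ^ 2|) ^ 2 := by
      rw [← sq_abs]
      exact pow_le_pow_left₀ (abs_nonneg _) h 2
    rw [abs_of_nonneg (sq_nonneg r)] at h2
    by_cases hr2 : r ^ 2 ∈ Set.Icc (l ^ 2) (2 * l ^ 2)
    · rw [Set.indicator_of_mem hr2, mul_one] at h2
      have hl2 : l ≤ r := (pow_le_pow_iff_left₀ hl.le hr.le two_ne_zero).1 hr2.1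
      have hr3 : r ∈ Set.Iic (2 * l) :=
        (pow_le_pow_iff_left₀ hr.le (by positivity) two_ne_zero).1
          (hr2.2.trans (by nlinarith [sq_nonneg l]))
      rw [Set.indicator_of_mem hr3, Pi.one_apply, mul_one, mul_comm]
      gcongr
    · rw [Set.indicator_of_notMem hr2, mul_zero, zero_pow two_ne_zero] at h2
      have h3 : (r ^ 2 * deriv (lineCutoff l) (r ^ 2)) ^ 2 = 0 := le_antisymm h2 (sq_nonneg _)
      rw [h3, mul_zero]
      have : (0 : ℝ) ≤ Set.indicator (Set.Iic (2 * l)) 1 r :=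
        Set.indicator_nonneg (fun _ _ => zero_le_one) _
      positivity
  refine ⟨(1 + 1 / τ) * (8 * C ^ 2), by positivity, fun κ δ r hκ hδ hr => ?_⟩
  rcases hr.eq_or_lt with rfl | hr
  · have h1 : (0 : ℝ) ≤ Set.indicator (Set.Iic (2 * κ)) 1 0 :=
      Set.indicator_nonneg (fun _ _ => zero_le_one) _
    have h2 : (0 : ℝ) ≤ Set.indicator (Set.Iic (2 * δ)) 1 0 :=
      Set.indicator_nonneg (fun _ _ => zero_le_one) _
    simp only [mul_zero, zero_mul, ne_eq, OfNat.ofNat_ne_zero, not_false_eq_true, zero_pow,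
      div_zero, zero_add]
    positivity
  have hs : 0 < r ^ 2 := by positivity
  have hd1 := ((contDiff_lineCutoff δ).differentiable (by simp) (r ^ 2)).hasDerivAt
  have hd2 := ((contDiff_lineCutoff κ).differentiable (by simp) (r ^ 2)).hasDerivAt
  have hd : HasDerivAt (criticalProfile α κ δ) _ (r ^ 2) :=
    (Real.hasDerivAt_rpow_const (p := -α / 2) (Or.inl hs.ne')).mul (hd1.mul (hd2.const_sub 1))
  have hu : (r ^ 2) ^ (-α / 2 - 1) = (r ^ 2) ^ (-α / 2) / r ^ 2 := by
    rw [Real.rpow_sub hs, Real.rpow_one]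
  have h1 := hterm δ r hδ hr
  have h2 := hterm κ r hκ hr
  rw [hd.deriv, sq_criticalProfile_div hα hr]
  rw [hu]
  have hE : 0 < (r ^ N)⁻¹ := by positivity
  have hu2 := rpow_neg_half_sq hα hr
  have hp0 := lineCutoff_nonneg δ (r ^ 2)
  have hp1 := lineCutoff_le_one δ (r ^ 2)
  have hq0 := lineCutoff_nonneg κ (r ^ 2)
  have hq1 := lineCutoff_le_one κ (r ^ 2)
  set u := (r ^ 2) ^ (-α / 2)
  set p := lineCutoff δ (r ^ 2)
  set q := lineCutoff κ (r ^ 2)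
  set p' := deriv (lineCutoff δ) (r ^ 2)
  set q' := deriv (lineCutoff κ) (r ^ 2)
  set E := (r ^ N)⁻¹
  have e1 : (2 * r * (-α / 2 * (u / r ^ 2) * (p * (1 - q)) + u * (p' * (1 - q) + p * -q'))) ^ 2 =
      E * (-α * (p * (1 - q)) + 2 * (r ^ 2 * p' * (1 - q) - r ^ 2 * q' * p)) ^ 2 := by
    have : 2 * r * (-α / 2 * (u / r ^ 2) * (p * (1 - q)) + u * (p' * (1 - q) + p * -q')) =
      u * r⁻¹ * (-α * (p * (1 - q)) + 2 * (r ^ 2 * p' * (1 - q) - r ^ 2 * q' * p)) := by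
      field_simp
      ring
    rw [this, mul_pow, mul_pow, hu2]
    field_simp
  have hyoung : ∀ x y : ℝ, (x + y) ^ 2 ≤ (1 + τ) * x ^ 2 + (1 + 1 / τ) * y ^ 2 := by
    intro x y
    have : (1 + τ) * x ^ 2 + (1 + 1 / τ) * y ^ 2 - (x + y) ^ 2 = (τ * x - y) ^ 2 / τ := by
      field_simp
      ring
    have h0 : 0 ≤ (τ * x - y) ^ 2 / τ := by positivity
    linarith
  have hcut : (2 * (r ^ 2 * p' * (1 - q) - r ^ 2 * q' * p)) ^ 2 ≤
      8 * ((r ^ 2 * p') ^ 2 + (r ^ 2 * q') ^ 2) := by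
    have hA : (r ^ 2 * p' * (1 - q)) ^ 2 ≤ (r ^ 2 * p') ^ 2 := by
      rw [mul_pow]
      exact mul_le_of_le_one_right (sq_nonneg _) (pow_le_one₀ (by linarith) (by linarith))
    have hB : (r ^ 2 * q' * p) ^ 2 ≤ (r ^ 2 * q') ^ 2 := by
      rw [mul_pow]
      exact mul_le_of_le_one_right (sq_nonneg _) (pow_le_one₀ hp0 hp1)
    linarith [sq_nonneg (r ^ 2 * p' * (1 - q) + r ^ 2 * q' * p)]
  rw [e1]
  have hT : 0 < 1 + 1 / τ := by positivity
  calc E * (-α * (p * (1 - q)) + 2 * (r ^ 2 * p' * (1 - q) - r ^ 2 * q' * p)) ^ 2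
      ≤ E * ((1 + τ) * (-α * (p * (1 - q))) ^ 2 +
          (1 + 1 / τ) * (8 * ((r ^ 2 * p') ^ 2 + (r ^ 2 * q') ^ 2))) := by
        refine mul_le_mul_of_nonneg_left ((hyoung _ _).trans ?_) hE.le
        gcongr
    _ = (1 + τ) * α ^ 2 * (E * (p * (1 - q)) ^ 2) +
          (1 + 1 / τ) * 8 * (E * (r ^ 2 * q') ^ 2 + E * (r ^ 2 * p') ^ 2) := by ring
    _ ≤ _ := by
        have h3 := mul_le_mul_of_nonneg_left (add_le_add h2 h1) (show 0 ≤ (1 + 1 / τ) * 8 by positivity)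
        linarith

end CriticalProfile

/-! ### Compactly supported test functions and their integrals. -/

section CompactlySupported

open Filter Metric
open scoped Topology

variable {N : ℕ}

theorem norm_gradient_eq_norm_fderiv (f : EuclideanSpace ℝ (Fin N) → ℝ)
    (x : EuclideanSpace ℝ (Fin N)) : ‖gradient f x‖ = ‖fderiv ℝ f x‖ :=
  LinearIsometryEquiv.norm_map _ _

theorem memH1_of_contDiff_of_hasCompactSupport {ρ f : EuclideanSpace ℝ (Fin N) → ℝ}
    (hρ : Continuous ρ) (hρ0 : ∀ x, 0 ≤ ρ x) (hf : ContDiff ℝ 1 f) (hfc : HasCompactSupport f) :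
    MemH1 (volume.withDensity fun x => ENNReal.ofReal (ρ x)) f (gradient f) := by
  have hdf : Continuous (fderiv ℝ f) := hf.continuous_fderiv one_ne_zero
  have hg : Continuous (gradient f) := (LinearIsometryEquiv.continuous _).comp hdf
  have hgc : HasCompactSupport (gradient f) :=
    (hfc.fderiv ℝ).comp_left (LinearIsometryEquiv.map_zero _)
  refine ⟨?_, ?_, hf.continuous.locallyIntegrable, hg.locallyIntegrable, fun ψ hψ hψc v => ?_⟩
  · rw [memLp_two_iff_integrable_sq hf.continuous.aestronglyMeasurable,
      integrable_withDensity_ofReal_iff hρ.measurable hρ0]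
    have hc : HasCompactSupport fun x => f x ^ 2 := hfc.comp_left (g := fun t : ℝ => t ^ 2) (by simp)
    exact (hρ.mul (hf.continuous.pow 2)).integrable_of_hasCompactSupport hc.mul_left
  · rw [memLp_two_iff_integrable_sq_norm hg.aestronglyMeasurable,
      integrable_withDensity_ofReal_iff hρ.measurable hρ0]
    have hc : HasCompactSupport fun x => ‖gradient f x‖ ^ 2 :=
      hgc.comp_left (g := fun y => ‖y‖ ^ 2) (by simp)
    exact (hρ.mul (hg.norm.pow 2)).integrable_of_hasCompactSupport hc.mul_left
  · have hψ1 : ContDiff ℝ 1 ψ := hψ.of_le (by simp)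
    have hdfv : Continuous fun x => fderiv ℝ f x v := hdf.clm_apply continuous_const
    have hdψv : Continuous fun x => fderiv ℝ ψ x v :=
      (hψ1.continuous_fderiv one_ne_zero).clm_apply continuous_const
    simp only [inner_gradient_left]
    exact integral_mul_fderiv_eq_neg_fderiv_mul_of_integrable
      ((hdfv.mul hψ.continuous).integrable_of_hasCompactSupport hψc.mul_left)
      ((hf.continuous.mul hdψv).integrable_of_hasCompactSupport hfc.mul_right)
      ((hf.continuous.mul hψ.continuous).integrable_of_hasCompactSupport hψc.mul_left)
      (fun x _ => hf.differentiable one_ne_zero x) (fun x _ => hψ1.differentiable one_ne_zero x)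

theorem norm_fderiv_comp_norm_sub_sq {h : ℝ → ℝ} (hh : Differentiable ℝ h)
    (p x : EuclideanSpace ℝ (Fin N)) :
    ‖fderiv ℝ (fun y => h (‖y - p‖ ^ 2)) x‖ = |2 * ‖x - p‖ * deriv h (‖x - p‖ ^ 2)| := by
  have h1 : HasFDerivAt (fun y : EuclideanSpace ℝ (Fin N) => ‖y - p‖ ^ 2)
      (2 • (innerSL ℝ (x - p)).comp (ContinuousLinearMap.id ℝ _)) x :=
    ((hasFDerivAt_id x).sub_const p).norm_sq
  have h2 := (hh (‖x - p‖ ^ 2)).hasDerivAt.comp_hasFDerivAt x h1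
  have h3 : fderiv ℝ (fun y => h (‖y - p‖ ^ 2)) x = _ := h2.fderiv
  rw [h3, norm_smul, ContinuousLinearMap.comp_id, two_smul, ← two_smul ℝ, norm_smul,
    innerSL_apply_norm, Real.norm_eq_abs, Real.norm_eq_abs, abs_mul, abs_mul, abs_norm]
  ring

/-- The volume of a ball of radius `2 l` scales like `l^N`, so the cutoff errors are bounded
independently of `l`. -/
theorem integral_indicator_closedBall_le {ρ : EuclideanSpace ℝ (Fin N) → ℝ} (hρ : Continuous ρ)
    {p : EuclideanSpace ℝ (Fin N)} {R ρM l : ℝ} (hl : 0 < l) (hlR : 2 * l ≤ R)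
    (hρM : ∀ x ∈ closedBall p R, ρ x ≤ ρM) :
    Integrable (fun x => ρ x * ((l ^ N)⁻¹ * Set.indicator (Set.Iic (2 * l)) 1 ‖x - p‖)) ∧
    ∫ x, ρ x * ((l ^ N)⁻¹ * Set.indicator (Set.Iic (2 * l)) 1 ‖x - p‖) ≤
      ρM * (2 ^ N * volume.real (ball (0 : EuclideanSpace ℝ (Fin N)) 1)) := by
  have e : (fun x => ρ x * ((l ^ N)⁻¹ * Set.indicator (Set.Iic (2 * l)) 1 ‖x - p‖)) =
      Set.indicator (closedBall p (2 * l)) fun x => (l ^ N)⁻¹ * ρ x := by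
    ext x
    by_cases hx : ‖x - p‖ ≤ 2 * l
    · rw [Set.indicator_of_mem (show ‖x - p‖ ∈ Set.Iic (2 * l) from hx), Set.indicator_of_mem
        (show x ∈ closedBall p (2 * l) from mem_closedBall_iff_norm.2 hx), Pi.one_apply]
      ring
    · rw [Set.indicator_of_notMem (show ‖x - p‖ ∉ Set.Iic (2 * l) from hx), Set.indicator_of_notMem
        (show x ∉ closedBall p (2 * l) from fun h => hx (mem_closedBall_iff_norm.1 h))]
      ring
  have hi : IntegrableOn (fun x => (l ^ N)⁻¹ * ρ x) (closedBall p (2 * l)) :=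
    (continuous_const.mul hρ).continuousOn.integrableOn_compact (isCompact_closedBall _ _)
  refine ⟨by rw [e]; exact hi.integrable_indicator measurableSet_closedBall, ?_⟩
  rw [e, integral_indicator measurableSet_closedBall]
  calc ∫ x in closedBall p (2 * l), (l ^ N)⁻¹ * ρ x
      ≤ ∫ x in closedBall p (2 * l), (l ^ N)⁻¹ * ρM := by
        refine setIntegral_mono_on hi (integrableOn_const measure_closedBall_lt_top.ne)
          measurableSet_closedBall fun x hx => ?_
        exact mul_le_mul_of_nonneg_left (hρM x (closedBall_subset_closedBall hlR hx))
          (by positivity)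
    _ = ρM * (2 ^ N * volume.real (ball (0 : EuclideanSpace ℝ (Fin N)) 1)) := by
        rw [setIntegral_const, Measure.addHaar_real_closedBall _ _ (by positivity),
          finrank_euclideanSpace_fin, smul_eq_mul, mul_pow]
        field_simp

theorem integral_indicator_inv_norm_pow (hN : N ≠ 0) (p : EuclideanSpace ℝ (Fin N)) {κ δ : ℝ}
    (hκ : 0 < κ) (hκδ : κ ≤ δ) :
    ∫ x : EuclideanSpace ℝ (Fin N),
        Set.indicator (Set.Ioc κ δ) (fun r => (r ^ N)⁻¹) ‖x - p‖ =
      N * volume.real (ball (0 : EuclideanSpace ℝ (Fin N)) 1) * Real.log (δ / κ) := by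
  have : Nonempty (Fin N) := ⟨⟨0, Nat.pos_of_ne_zero hN⟩⟩
  rw [integral_sub_right_eq_self (fun x : EuclideanSpace ℝ (Fin N) =>
    Set.indicator (Set.Ioc κ δ) (fun r => (r ^ N)⁻¹) ‖x‖) p,
    integral_fun_norm_addHaar volume (Set.indicator (Set.Ioc κ δ) fun r => (r ^ N)⁻¹),
    finrank_euclideanSpace_fin, nsmul_eq_mul, smul_eq_mul, mul_assoc]
  congr 2
  have e : ∀ y ∈ Set.Ioi (0 : ℝ), y ^ (N - 1) • Set.indicator (Set.Ioc κ δ) (fun r => (r ^ N)⁻¹) y =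
      Set.indicator (Set.Ioc κ δ) (fun r => r⁻¹) y := by
    intro y hy
    have hy0 : y ≠ 0 := (Set.mem_Ioi.1 hy).ne'
    by_cases h : y ∈ Set.Ioc κ δ
    · rw [Set.indicator_of_mem h, Set.indicator_of_mem h, smul_eq_mul]
      obtain ⟨m, rfl⟩ := Nat.exists_eq_succ_of_ne_zero hN
      rw [Nat.succ_sub_one, pow_succ]
      field_simp
    · rw [Set.indicator_of_notMem h, Set.indicator_of_notMem h, smul_zero]
  rw [setIntegral_congr_fun measurableSet_Ioi e, setIntegral_indicator measurableSet_Ioc,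
    Set.inter_eq_self_of_subset_right (show Set.Ioc κ δ ⊆ Set.Ioi 0 from fun y hy => hκ.trans hy.1),
    ← intervalIntegral.integral_of_le hκδ, integral_inv_of_pos hκ (hκ.trans_le hκδ)]

end CompactlySupported

/-! ### Optimality of the constant. -/

section Optimality

open Filter Metric
open scoped Topology

variable {N n : ℕ}

/-- Let `I` be the Hardy integral of the test function at `p`. The gap `c - α²` is spent in three
portions: a quarter on the factor `1 + τ`, a quarter on the `K` term through small `δ`, and half on
the cutoff error `D` through small `κ`. The order matters: `D` depends on `δ` but not on `κ`. -/
theorem exists_hardy_lt (hN : 3 ≤ N) {ρ V : EuclideanSpace ℝ (Fin N) → ℝ} (hρ : Continuous ρ)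
    (hρ0 : ∀ x, 0 < ρ x) {p : EuclideanSpace ℝ (Fin N)} (hV : ∀ x, 1 / ‖x - p‖ ^ 2 ≤ V x)
    (hVi : ∀ f : EuclideanSpace ℝ (Fin N) → ℝ, ContDiff ℝ 1 f → HasCompactSupport f →
      Integrable fun x => ρ x * (V x * f x ^ 2)) {c : ℝ} (hc : hardyConst N < c) (K : ℝ) :
    ∃ f : EuclideanSpace ℝ (Fin N) → ℝ, ContDiff ℝ 1 f ∧ HasCompactSupport f ∧
      (∫ x, ρ x * ‖fderiv ℝ f x‖ ^ 2) + K * (∫ x, ρ x * f x ^ 2) <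
        c * ∫ x, ρ x * (V x * f x ^ 2) := by
  obtain ⟨α, hα⟩ : ∃ α : ℝ, α = ((N : ℝ) - 2) / 2 := ⟨_, rfl⟩
  have hco : hardyConst N = α ^ 2 := by rw [hα, hardyConst]
  rw [hco] at hc
  have hN' : (3 : ℝ) ≤ N := by exact_mod_cast hN
  have hα0 : 0 < α := by rw [hα]; linarith
  have hc0 : 0 < c := lt_of_le_of_lt (sq_nonneg α) hc
  set τ := (c - α ^ 2) / (4 * α ^ 2) with hτdef
  have hτ : 0 < τ := div_pos (sub_pos.2 hc) (by positivity)
  have hτα : (1 + τ) * α ^ 2 = α ^ 2 + (c - α ^ 2) / 4 := by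
    rw [hτdef]
    field_simp
  obtain ⟨M, hM0, hM⟩ := exists_sq_deriv_criticalProfile_le hα hτ
  obtain ⟨δ, hδ, hKδ⟩ : ∃ δ : ℝ, 0 < δ ∧ |K| * (2 * δ ^ 2) ≤ (c - α ^ 2) / 4 := by
    have h : Tendsto (fun δ : ℝ => |K| * (2 * δ ^ 2)) (𝓝[>] 0) (𝓝 0) := by
      have : Tendsto (fun δ : ℝ => |K| * (2 * δ ^ 2)) (𝓝 0) (𝓝 (|K| * (2 * 0 ^ 2))) :=
        (Continuous.tendsto (by fun_prop) 0)
      simpa using this.mono_left nhdsWithin_le_nhds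
    have hpos : 0 < (c - α ^ 2) / 4 := by linarith
    obtain ⟨δ, h1, h2⟩ := ((h.eventually_lt_const hpos).and self_mem_nhdsWithin).exists
    exact ⟨δ, h2, h1.le⟩
  obtain ⟨xM, -, hxM⟩ := (isCompact_closedBall p (2 * δ)).exists_isMaxOn
    ⟨p, mem_closedBall_self (by positivity)⟩ hρ.continuousOn
  obtain ⟨xm, -, hxm⟩ := (isCompact_closedBall p (2 * δ)).exists_isMinOn
    ⟨p, mem_closedBall_self (by positivity)⟩ hρ.continuousOn
  have hMax : ∀ x ∈ closedBall p (2 * δ), ρ x ≤ ρ xM := fun x hx => hxM hx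
  have hMin : ∀ x ∈ closedBall p (2 * δ), ρ xm ≤ ρ x := fun x hx => hxm hx
  set w := volume.real (ball (0 : EuclideanSpace ℝ (Fin N)) 1) with hwdef
  have hw_pos : 0 < w := ENNReal.toReal_pos (measure_ball_pos _ _ one_pos).ne' measure_ball_lt_top.ne
  set D := M * (2 * (ρ xM * (2 ^ N * w))) with hD
  have hb : 0 < ρ xm * (N * w) := by have := hρ0 xm; positivity
  -- `κ` is chosen below so that `log (δ / (2κ)) = L`, hence `I ≥ 2 D / (c - α²) + 1`; the summand
  -- `1` makes the final inequality strict.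
  set L := (2 * D / (c - α ^ 2) + 1) / (ρ xm * (N * w)) with hL
  have hD0 : 0 ≤ D := by have := hρ0 xM; positivity
  have hL0 : 0 ≤ L := by
    have := sub_pos.2 hc
    positivity
  set κ := δ * Real.exp (-L) / 2 with hκdef
  have hκ : 0 < κ := by positivity
  have hκδ : 2 * κ ≤ δ := by
    have : Real.exp (-L) ≤ 1 := Real.exp_le_one_iff.2 (by linarith)
    rw [hκdef]
    nlinarith
  set f : EuclideanSpace ℝ (Fin N) → ℝ := fun x => criticalProfile α κ δ (‖x - p‖ ^ 2) with hf
  have hh := contDiff_criticalProfile (α := α) (δ := δ) hκ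
  have hfc : ContDiff ℝ 1 f :=
    (hh.of_le (by simp)).comp ((contDiff_id.sub contDiff_const).norm_sq ℝ)
  have hfz : ∀ x, 2 * δ ^ 2 ≤ ‖x - p‖ ^ 2 → f x = 0 := fun x hx =>
    criticalProfile_eq_zero_of_ge hδ (hx.trans (le_abs_self _))
  have hfs : HasCompactSupport f := by
    refine HasCompactSupport.intro (isCompact_closedBall p (2 * δ)) fun x hx => hfz x ?_
    rw [mem_closedBall_iff_norm, not_le] at hx
    nlinarith
  have hgrad : ∀ x, ‖fderiv ℝ f x‖ ^ 2 ≤ (1 + τ) * α ^ 2 * (f x ^ 2 / ‖x - p‖ ^ 2) +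
      M * ((κ ^ N)⁻¹ * Set.indicator (Set.Iic (2 * κ)) 1 ‖x - p‖ +
        (δ ^ N)⁻¹ * Set.indicator (Set.Iic (2 * δ)) 1 ‖x - p‖) := by
    intro x
    rw [hf, norm_fderiv_comp_norm_sub_sq (hh.differentiable (by simp)), sq_abs]
    exact hM κ δ ‖x - p‖ hκ hδ (norm_nonneg _)
  have hsq : ∀ x, f x ^ 2 ≤ 2 * δ ^ 2 * (f x ^ 2 / ‖x - p‖ ^ 2) := by
    intro x
    rcases le_or_gt (2 * δ ^ 2) (‖x - p‖ ^ 2) with h | h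
    · simp [hfz x h]
    · rcases (sq_nonneg ‖x - p‖).eq_or_lt with h0 | h0
      · have : f x = 0 := by
          rw [hf]
          simp only [← h0]
          exact criticalProfile_eq_zero_of_le hκ (by rw [abs_zero]; positivity)
        simp [this]
      · rw [mul_div_assoc', le_div_iff₀ h0, mul_comm]
        exact mul_le_mul_of_nonneg_right h.le (sq_nonneg _)
  have hψV : ∀ x, f x ^ 2 / ‖x - p‖ ^ 2 ≤ V x * f x ^ 2 := by
    intro x
    rw [div_eq_mul_one_div, mul_comm]
    exact mul_le_mul_of_nonneg_right (hV x) (sq_nonneg _)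
  have iV := hVi f hfc hfs
  have iψ : Integrable fun x => ρ x * (f x ^ 2 / ‖x - p‖ ^ 2) := by
    refine iV.mono' ?_ (Eventually.of_forall fun x => ?_)
    · exact (hρ.measurable.mul ((hfc.continuous.measurable.pow_const 2).div
        ((continuous_id.sub continuous_const).norm.measurable.pow_const 2))).aestronglyMeasurable
    · have := (hρ0 x).le
      rw [Real.norm_of_nonneg (by positivity)]
      exact mul_le_mul_of_nonneg_left (hψV x) (hρ0 x).le
  set I := ∫ x, ρ x * (f x ^ 2 / ‖x - p‖ ^ 2) with hI
  have hIV : I ≤ ∫ x, ρ x * (V x * f x ^ 2) :=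
    integral_mono iψ iV fun x => mul_le_mul_of_nonneg_left (hψV x) (hρ0 x).le
  have hIsq : (∫ x, ρ x * f x ^ 2) ≤ 2 * δ ^ 2 * I := by
    rw [hI, ← integral_const_mul]
    refine integral_mono_of_nonneg (Eventually.of_forall fun x => ?_) (iψ.const_mul _)
      (Eventually.of_forall fun x => ?_)
    · exact mul_nonneg (hρ0 x).le (sq_nonneg _)
    · have := mul_le_mul_of_nonneg_left (hsq x) (hρ0 x).le
      simp only
      linarith
  obtain ⟨iκ, hκI⟩ := integral_indicator_closedBall_le hρ hκ (by linarith : 2 * κ ≤ 2 * δ) hMax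
  obtain ⟨iδ, hδI⟩ := integral_indicator_closedBall_le hρ hδ le_rfl hMax
  have hIgrad : (∫ x, ρ x * ‖fderiv ℝ f x‖ ^ 2) ≤ (1 + τ) * α ^ 2 * I + D := by
    have i1 := iψ.const_mul ((1 + τ) * α ^ 2)
    have i2 : Integrable fun x =>
        M * (ρ x * ((κ ^ N)⁻¹ * Set.indicator (Set.Iic (2 * κ)) 1 ‖x - p‖) +
          ρ x * ((δ ^ N)⁻¹ * Set.indicator (Set.Iic (2 * δ)) 1 ‖x - p‖)) :=
      (iκ.add iδ).const_mul M
    calc (∫ x, ρ x * ‖fderiv ℝ f x‖ ^ 2)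
        ≤ ∫ x, ((1 + τ) * α ^ 2 * (ρ x * (f x ^ 2 / ‖x - p‖ ^ 2)) +
          M * (ρ x * ((κ ^ N)⁻¹ * Set.indicator (Set.Iic (2 * κ)) 1 ‖x - p‖) +
            ρ x * ((δ ^ N)⁻¹ * Set.indicator (Set.Iic (2 * δ)) 1 ‖x - p‖))) := by
          refine integral_mono_of_nonneg (Eventually.of_forall fun x => ?_) (i1.add i2)
            (Eventually.of_forall fun x => ?_)
          · exact mul_nonneg (hρ0 x).le (sq_nonneg _)
          · have := mul_le_mul_of_nonneg_left (hgrad x) (hρ0 x).le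
            simp only
            linarith
      _ = (1 + τ) * α ^ 2 * I +
          M * ((∫ x, ρ x * ((κ ^ N)⁻¹ * Set.indicator (Set.Iic (2 * κ)) 1 ‖x - p‖)) +
            ∫ x, ρ x * ((δ ^ N)⁻¹ * Set.indicator (Set.Iic (2 * δ)) 1 ‖x - p‖)) := by
          rw [integral_add i1 i2, integral_const_mul, integral_const_mul, integral_add iκ iδ]
      _ ≤ (1 + τ) * α ^ 2 * I + D := by
          have := mul_le_mul_of_nonneg_left (add_le_add hκI hδI) hM0
          linarith
  have hlog : ρ xm * (N * w) * L ≤ I := by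
    have h1 := integral_indicator_inv_norm_pow (by omega : N ≠ 0) p
      (by positivity : 0 < 2 * κ) hκδ
    have h2 : Real.log (δ / (2 * κ)) = L := by
      have : δ / (2 * κ) = Real.exp L := by
        rw [hκdef, Real.exp_neg]
        field_simp
      rw [this, Real.log_exp]
    rw [h2, ← hwdef] at h1
    rw [mul_assoc, ← h1, ← integral_const_mul]
    refine integral_mono_of_nonneg (Eventually.of_forall fun x => ?_) iψ
      (Eventually.of_forall fun x => ?_)
    · exact mul_nonneg (hρ0 xm).le (Set.indicator_nonneg (fun r hr => by
        have : 0 < r := (by positivity : 0 < 2 * κ).trans hr.1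
        positivity) _)
    · by_cases hx : ‖x - p‖ ∈ Set.Ioc (2 * κ) δ
      · have hx0 : 0 < ‖x - p‖ := (by positivity : 0 < 2 * κ).trans hx.1
        simp only [hf]
        rw [Set.indicator_of_mem hx, sq_criticalProfile_div hα hx0, lineCutoff_eq_one hδ,
          lineCutoff_eq_zero hκ, sub_zero, one_mul, one_pow, mul_one]
        · exact mul_le_mul_of_nonneg_right (hMin x (mem_closedBall_iff_norm.2
            (hx.2.trans (by linarith)))) (by positivity)
        · rw [abs_of_nonneg (sq_nonneg _)]
          nlinarith [hx.1]
        · rw [abs_of_nonneg (sq_nonneg _)]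
          exact pow_le_pow_left₀ (norm_nonneg _) hx.2 2
      · simp only
        rw [Set.indicator_of_notMem hx, mul_zero]
        have := (hρ0 x).le
        positivity
  have hbig : 2 * D / (c - α ^ 2) < I := by
    have : ρ xm * (N * w) * L = 2 * D / (c - α ^ 2) + 1 :=
      mul_div_cancel₀ _ hb.ne'
    linarith
  rw [div_lt_iff₀ (sub_pos.2 hc)] at hbig
  have hI0 : 0 ≤ I := le_trans (mul_nonneg hb.le hL0) hlog
  have hJ0 : 0 ≤ ∫ x, ρ x * f x ^ 2 :=
    integral_nonneg fun x => mul_nonneg (hρ0 x).le (sq_nonneg _)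
  have hK : K * (∫ x, ρ x * f x ^ 2) ≤ (c - α ^ 2) / 4 * I :=
    calc K * (∫ x, ρ x * f x ^ 2) ≤ |K| * (∫ x, ρ x * f x ^ 2) :=
          mul_le_mul_of_nonneg_right (le_abs_self K) hJ0
      _ ≤ |K| * (2 * δ ^ 2 * I) := mul_le_mul_of_nonneg_left hIsq (abs_nonneg K)
      _ = |K| * (2 * δ ^ 2) * I := by ring
      _ ≤ (c - α ^ 2) / 4 * I := mul_le_mul_of_nonneg_right hKδ hI0
  have hcV := mul_le_mul_of_nonneg_left hIV hc0.le
  refine ⟨f, hfc, hfs, ?_⟩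
  rw [hτα] at hIgrad
  linarith

theorem exists_multipolar_hardy_lt (hN : 3 ≤ N) (hn : 2 ≤ n) {A : Matrix (Fin N) (Fin N) ℝ}
    (hA : A.PosDef) {a : Fin n → EuclideanSpace ℝ (Fin N)} (ha : Function.Injective a)
    {c : ℝ} (hc : hardyConst N < c) (K : ℝ) :
    ∃ φ G, MemH1 (gaussianMeasure A a) φ G ∧
      ∫ x, ‖G x‖ ^ 2 ∂(gaussianMeasure A a) + K * ∫ x, φ x ^ 2 ∂(gaussianMeasure A a) <
        c * ∫ x, multipolarPotential a x * φ x ^ 2 ∂(gaussianMeasure A a) := by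
  set ρ : EuclideanSpace ℝ (Fin N) → ℝ := fun x => gaussianConst A a * gaussianWeight A a x
    with hρdef
  have hρ : Continuous ρ := continuous_const.mul (contDiff_gaussianWeight A a).continuous
  have hρ0 : ∀ x, 0 < ρ x := fun x =>
    mul_pos (gaussianConst_pos (by omega) hA a) (gaussianWeight_pos A a x)
  have hμ : gaussianMeasure A a = volume.withDensity fun x => ENNReal.ofReal (ρ x) := rfl
  have hρ0' : ∀ x, 0 ≤ ρ x := fun x => (hρ0 x).le
  have hmem : ∀ f : EuclideanSpace ℝ (Fin N) → ℝ, ContDiff ℝ 1 f → HasCompactSupport f →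
      MemH1 (gaussianMeasure A a) f (gradient f) := fun f hf hfc =>
    memH1_of_contDiff_of_hasCompactSupport hρ hρ0' hf hfc
  let i₀ : Fin n := ⟨0, by omega⟩
  obtain ⟨f, hf, hfc, hlt⟩ := exists_hardy_lt hN hρ hρ0 (p := a i₀) (V := multipolarPotential a)
    (fun x => Finset.single_le_sum (f := fun i => 1 / ‖x - a i‖ ^ 2) (fun i _ => by positivity)
      (Finset.mem_univ i₀))
    -- The upper bound supplies integrability; otherwise the integral on the right could take the
    -- default value `0`.
    (fun f hf hfc => (integrable_withDensity_ofReal_iff hρ.measurable hρ0').1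
      (multipolar_hardy hN hn hA ha (hmem f hf hfc)).1) hc K
  refine ⟨f, gradient f, hmem f hf hfc, ?_⟩
  rw [hμ, integral_withDensity_ofReal hρ.measurable hρ0',
    integral_withDensity_ofReal hρ.measurable hρ0', integral_withDensity_ofReal hρ.measurable hρ0']
  simpa only [norm_gradient_eq_norm_fderiv] using hlt

end Optimality

theorem theorem3p1 (N n : ℕ) (hN : 3 ≤ N) (hn : 2 ≤ n)
    (A : Matrix (Fin N) (Fin N) ℝ) (hA : A.PosDef)
    (a : Fin n → EuclideanSpace ℝ (Fin N)) (ha : Function.Injective a) :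
    (∀ k : ℝ, 0 ≤ k → k < Real.pi ^ 2 → ∀ c : ℝ, 0 < c → c ≤ hardyConst N →
      ∀ φ G, MemH1 (gaussianMeasure A a) φ G →
        Integrable (fun x => multipolarPotential a x * φ x ^ 2) (gaussianMeasure A a) ∧
        c * ∫ x, multipolarPotential a x * φ x ^ 2 ∂(gaussianMeasure A a) ≤
          ∫ x, ‖G x‖ ^ 2 ∂(gaussianMeasure A a) +
            ((k + ((n : ℝ) + 1) * c) / poleRadius a ^ 2 + (n : ℝ) / 2 * A.trace) *
              ∫ x, φ x ^ 2 ∂(gaussianMeasure A a)) ∧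
    (∀ c : ℝ, hardyConst N < c → ∀ K : ℝ,
      ∃ φ G, MemH1 (gaussianMeasure A a) φ G ∧
        ∫ x, ‖G x‖ ^ 2 ∂(gaussianMeasure A a) + K * ∫ x, φ x ^ 2 ∂(gaussianMeasure A a) <
          c * ∫ x, multipolarPotential a x * φ x ^ 2 ∂(gaussianMeasure A a)) := by
  refine ⟨fun k hk _ c hc hco φ G hφ => ?_, fun c hc K =>
    exists_multipolar_hardy_lt hN hn hA ha hc K⟩
  obtain ⟨hint, hle⟩ := multipolar_hardy hN hn hA ha hφ
  refine ⟨hint, ?_⟩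
  have hco0 : 0 < hardyConst N := hc.trans_le hco
  have ht1 : c / hardyConst N ≤ 1 := (div_le_one hco0).2 hco
  have ht0 : 0 ≤ c / hardyConst N := by positivity
  have hG0 : 0 ≤ ∫ x, ‖G x‖ ^ 2 ∂(gaussianMeasure A a) := integral_nonneg fun x => sq_nonneg _
  have hφ0 : 0 ≤ ∫ x, φ x ^ 2 ∂(gaussianMeasure A a) := integral_nonneg fun x => sq_nonneg _
  have htr : 0 ≤ (n : ℝ) / 2 * A.trace := mul_nonneg (by positivity) hA.posSemidef.trace_nonneg
  -- Scaling the critical inequality by `c / c_o ≤ 1` turns `(n + 1) c_o` into `(n + 1) c`. The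
  -- gradient and trace terms only shrink, so they may be restored to full size, and `k ≥ 0` is
  -- slack.
  have hscaled := mul_le_mul_of_nonneg_left hle ht0
  set V := ∫ x, multipolarPotential a x * φ x ^ 2 ∂(gaussianMeasure A a)
  set E := ∫ x, ‖G x‖ ^ 2 ∂(gaussianMeasure A a)
  set S := ∫ x, φ x ^ 2 ∂(gaussianMeasure A a)
  set T := (n : ℝ) / 2 * A.trace
  calc c * V = c / hardyConst N * (hardyConst N * V) := by field_simp
    _ ≤ c / hardyConst N * (E + (((n : ℝ) + 1) * hardyConst N / poleRadius a ^ 2 + T) * S) :=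
        hscaled
    _ = c / hardyConst N * E + (((n : ℝ) + 1) * c / poleRadius a ^ 2 + c / hardyConst N * T) * S := by
        field_simp
    _ ≤ E + ((k + ((n : ℝ) + 1) * c) / poleRadius a ^ 2 + T) * S := by
        refine add_le_add (mul_le_of_le_one_left hG0 ht1) (mul_le_mul_of_nonneg_right ?_ hφ0)
        refine add_le_add (div_le_div_of_nonneg_right (by linarith) (sq_nonneg _))
          (mul_le_of_le_one_left htr ht1)
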